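/- Let $(M,g)$ be an oriented pseudo-Riemannian manifold of signature $(r,s)$, $D=r+s\ge 3$ (smooth, connected, paracompact, Hausdorff), and let $d_\gamma=2^{\lfloor D/2\rfloor}$. Fix constant Dirac matrices $\gamma_a\in\mathrm{Mat}(d_\gamma,\mathbb C)$ with $\{\gamma_a,\gamma_b\}=-2\eta_{ab}\mathbb 1$, where $\eta=\mathrm{diag}(1,\dots,1,-1,\dots,-1)$ has $r$ entries $1$ and $s$ entries $-1$; write $\gamma(v)=v^a\gamma_a$. They define a representation $\varphi$ on $\mathbb C^{d_\gamma}$ of $G=\mathrm{Spin}(r,s)$ (the group of even products of vectors of square length $\pm1$ in the Clifford algebra of $\mathbb R^{r,s}$), respectively of $G=\mathrm{Spin}^{\mathbb C}(r,s)=(\mathrm{Spin}(r,s)\times \mathrm U(1))/\{\pm(1,1)\}$, where $\varphi([h,u])=u\,\varphi(h)$. Suppose that a $\mathrm{Spin}$ structure, respectively a $\mathrm{Spin}^{\mathbb C}$ structure, on $(M,g)$ is given: a principal $G$-bundle $P\to M$ with a smooth equivariant bundle map $\Phi:P\to \mathrm{SO}(M)$ (and, in the $\mathrm{Spin}^{\mathbb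 C}$ case, a principal $\mathrm U(1)$-bundle $\mathrm U_1(M)$ such that $\Phi$ is the first component of an equivariant bundle map $P\to\mathrm{SO}(M)\times_M \mathrm U_1(M)$ with respect to $[h,u]\mapsto(\Pi(h),u^2)$, $\Pi:\mathrm{Spin}(r,s)\to\mathrm{SO}(r,s)$ being the double covering). Let $E=P\times_{\varphi}\mathbb C^{d_\gamma}$ be the spinor bundle. Then there is a smooth section $\gamma$ of $T^*M\otimes\mathrm{End}(E)$, the Dirac structure, with $\{\gamma(X),\gamma(Y)\}=-2g(X,Y)\mathbb 1$ and $\gamma(\Phi(p)v)[p,\psi]=[p,\gamma(v)\psi]$ for all $p\in P$, $v\in\mathbb R^{D}$, $\psi\in\mathbb C^{d_\gamma}$, and the following hold. 1. The homomorphism $\varphi:G\to\mathrm{GL}(d_\gamma,\mathbb C)$ is injective, and the structure group of $E$ extends along it to $\mathrm{GL}(d_\gamma,\mathbb C)$: there are a principal $\mathrm{GL}(d_\gamma,\mathbb C)$-bundle $P^G$ and a smooth, injective, $\varphi$-equivariant bundle map $\iota:P\to P^G$ over $M$ such that $[p,\psi]\mapsto[\iota(p),\psi]$ is a well-defined fibrewise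 complex-linear diffeomorphism $\theta$ from $E$ onto the bundle $E^G=P^G\times_{\mathrm{GL}(d_\gamma,\mathbb C)}\mathbb C^{d_\gamma}$. 2. $T^*M\otimes\mathrm{End}(E^G)$ has structure group $\mathrm{GL}(D,\mathbb R)\times\mathrm{GL}(d_\gamma,\mathbb C)$, with the space-time index and the spinor indices transforming separately: if $L(M)$ is the bundle of all linear frames of $M$, then $T^*M\otimes\mathrm{End}(E^G)$ is isomorphic, by a fibrewise linear diffeomorphism, to the bundle associated to the principal $\mathrm{GL}(D,\mathbb R)\times\mathrm{GL}(d_\gamma,\mathbb C)$-bundle $L(M)\times_M P^G$ and the representation $(A,S)\cdot T=S\circ T(A^{-1}\,\cdot\,)\circ S^{-1}$ on $(\mathbb R^D)^*\otimes\mathrm{End}(\mathbb C^{d_\gamma})$; the isomorphism sends $[(f,q),T]$ to the map with $f(v)\mapsto\big([q,\psi]\mapsto[q,T(v)\psi]\big)$. 3. $\gamma$ extends naturally to a section of $T^*M\otimes\mathrm{End}(E^G)$: there is a unique smooth section $\gamma^G$ of $T^*M\otimes\mathrm{End}(E^G)$ with $\{\gamma^G(X),\gamma^G(Y)\}=-2g(X,Y)\mathbb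 1$ and $\gamma^G(X)\circ\theta=\theta\circ\gamma(X)$ for all tangent vectors $X$. -/

import Mathlib

open scoped Manifold ContDiff Bundle Matrix

noncomputable section

namespace SpinBase

/-! ### The flat model: Clifford algebra, spin groups, Dirac matrices -/

/-- `ℝ^D = ℝ^r ⊕ ℝ^s`, `D = r + s`, the standard space of signature `(r, s)`. -/
abbrev SigSpace (r s : ℕ) : Type := (Fin r ⊕ Fin s) → ℝ

/-- The diagonal entries of `η`: `r` times `1` and `s` times `-1`. -/
def sgn {r s : ℕ} : Fin r ⊕ Fin s → ℝ := Sum.elim (fun _ => 1) (fun _ => -1)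

/-- The standard scalar product of signature `(r, s)`. -/
def eta {r s : ℕ} (v w : SigSpace r s) : ℝ := ∑ a, sgn a * (v a * w a)

/-- The quadratic form `v ↦ -⟨v, v⟩`, so that `v · v = -⟨v, v⟩` in the Clifford algebra. -/
def cliffordForm (r s : ℕ) : QuadraticForm ℝ (SigSpace r s) :=
  QuadraticMap.weightedSumSquares ℝ (fun a : Fin r ⊕ Fin s => -sgn a)

theorem cliffordForm_apply {r s : ℕ} (v : SigSpace r s) : cliffordForm r s v = -eta v v := by
  simp [cliffordForm, eta, QuadraticMap.weightedSumSquares_apply]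

/-- The real Clifford algebra `Cl(r, s)`. -/
abbrev Cl (r s : ℕ) : Type := CliffordAlgebra (cliffordForm r s)

/-- The inclusion `ℝ^{r,s} ⊂ Cl(r, s)`. -/
abbrev vec {r s : ℕ} : SigSpace r s →ₗ[ℝ] Cl r s := CliffordAlgebra.ι (cliffordForm r s)

theorem vec_injective {r s : ℕ} : Function.Injective (vec : SigSpace r s →ₗ[ℝ] Cl r s) := by
  intro v w h
  rw [← sub_eq_zero]
  funext a
  have h0 : CliffordAlgebra.ι (cliffordForm r s) (v - w) = 0 := by
    rw [map_sub]; exact sub_eq_zero.2 h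
  have := CliffordAlgebra.contractLeft_ι (Q := cliffordForm r s) (LinearMap.proj a) (v - w)
  rw [h0, map_zero] at this
  simpa using (FaithfulSMul.algebraMap_injective ℝ (Cl r s))
    (this.symm.trans (map_zero _).symm)

/-- A vector of "length squared" `±1`. -/
def IsUnitVec {r s : ℕ} (v : SigSpace r s) : Prop := eta v v = 1 ∨ eta v v = -1

/-- `Spin(r, s)`: the group of even products of vectors of length squared `±1` in `Cl(r, s)`
(the double cover of the whole of `SO(r, s)`). -/
def Spin (r s : ℕ) : Subgroup (Cl r s)ˣ :=
  Subgroup.closure {x | ∃ v w : SigSpace r s, IsUnitVec v ∧ IsUnitVec w ∧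
    (x : Cl r s) = vec v * vec w}

theorem IsUnitVec.isUnit {r s : ℕ} {v : SigSpace r s} (hv : IsUnitVec v) : IsUnit (vec v) := by
  apply CliffordAlgebra.isUnit_ι_of_isUnit
  rw [cliffordForm_apply]
  rcases hv with h | h <;> simp [h]

theorem Spin_le_lipschitzGroup (r s : ℕ) : Spin r s ≤ lipschitzGroup (cliffordForm r s) := by
  refine (Subgroup.closure_le _).2 ?_
  rintro x ⟨v, w, hv, hw, hx⟩
  have : x = hv.isUnit.unit * hw.isUnit.unit := Units.ext (by simpa using hx)
  rw [this]
  exact mul_mem (Subgroup.subset_closure ⟨v, rfl⟩) (Subgroup.subset_closure ⟨w, rfl⟩)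

theorem exists_conj_vec {r s : ℕ} (g : Spin r s) (v : SigSpace r s) :
    ∃ w, vec w = ((g : (Cl r s)ˣ) : Cl r s) * vec v * (((g : (Cl r s)ˣ)⁻¹ : (Cl r s)ˣ) : Cl r s) :=
  lipschitzGroup.conjAct_smul_ι_mem_range_ι (Spin_le_lipschitzGroup r s g.2) v

/-- The vector `w = Π(g) v` determined by `w = g v g⁻¹` in the Clifford algebra. -/
def coverFun {r s : ℕ} (g : Spin r s) (v : SigSpace r s) : SigSpace r s :=
  (exists_conj_vec g v).choose

theorem vec_coverFun {r s : ℕ} (g : Spin r s) (v : SigSpace r s) :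
    vec (coverFun g v) =
      ((g : (Cl r s)ˣ) : Cl r s) * vec v * (((g : (Cl r s)ˣ)⁻¹ : (Cl r s)ˣ) : Cl r s) :=
  (exists_conj_vec g v).choose_spec

/-- The covering homomorphism `Π : Spin(r, s) → SO(r, s) ⊂ GL(ℝ^{r,s})`, `Π(g) v = g v g⁻¹`. -/
def spinCover (r s : ℕ) : Spin r s →* (SigSpace r s ≃ₗ[ℝ] SigSpace r s) where
  toFun g :=
    { toFun := coverFun g
      map_add' := fun v w => vec_injective (by
        rw [map_add, vec_coverFun, vec_coverFun, vec_coverFun, map_add, mul_add, add_mul])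
      map_smul' := fun c v => vec_injective (by
        rw [map_smul, vec_coverFun, vec_coverFun, map_smul]
        simp)
      invFun := coverFun g⁻¹
      left_inv := fun v => vec_injective (by
        rw [vec_coverFun, vec_coverFun]; simp [mul_assoc])
      right_inv := fun v => vec_injective (by
        rw [vec_coverFun, vec_coverFun]; simp [mul_assoc]) }
  map_one' := by
    ext1 v
    exact vec_injective (by erw [vec_coverFun]; simp)
  map_mul' g h := by
    ext1 v
    refine vec_injective ?_
    erw [vec_coverFun, vec_coverFun, vec_coverFun]
    simp [mul_assoc]

/-- The subgroup `{(1, 1), (-1, -1)} ≅ ℤ/2` of `Spin(r, s) × U(1)`. -/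
def signSubgroup (r s : ℕ) : Subgroup (Spin r s × Circle) where
  carrier := {p | ((p.1 : (Cl r s)ˣ) = 1 ∧ (p.2 : ℂ) = 1) ∨
    ((p.1 : (Cl r s)ˣ) = -1 ∧ (p.2 : ℂ) = -1)}
  one_mem' := Or.inl (by simp)
  mul_mem' := by
    rintro a b (⟨ha, ha'⟩ | ⟨ha, ha'⟩) (⟨hb, hb'⟩ | ⟨hb, hb'⟩)
    · exact Or.inl (by rw [Prod.fst_mul, Prod.snd_mul]; push_cast; simp [ha, ha', hb, hb'])
    · exact Or.inr (by rw [Prod.fst_mul, Prod.snd_mul]; push_cast; simp [ha, ha', hb, hb'])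
    · exact Or.inr (by rw [Prod.fst_mul, Prod.snd_mul]; push_cast; simp [ha, ha', hb, hb'])
    · exact Or.inl (by rw [Prod.fst_mul, Prod.snd_mul]; push_cast; simp [ha, ha', hb, hb'])
  inv_mem' := by
    rintro a (⟨ha, ha'⟩ | ⟨ha, ha'⟩)
    · exact Or.inl (by rw [Prod.fst_inv, Prod.snd_inv]; push_cast; simp [ha, ha'])
    · exact Or.inr (by rw [Prod.fst_inv, Prod.snd_inv]; push_cast; simp [ha, ha', inv_neg])

instance signSubgroup_normal (r s : ℕ) : (signSubgroup r s).Normal where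
  conj_mem := by
    rintro n (⟨h, h'⟩ | ⟨h, h'⟩) g
    · exact Or.inl (by
        rw [Prod.fst_mul, Prod.snd_mul, Prod.fst_mul, Prod.snd_mul]; push_cast; simp [h, h'])
    · exact Or.inr (by
        rw [Prod.fst_mul, Prod.snd_mul, Prod.fst_mul, Prod.snd_mul]; push_cast; simp [h, h'])

/-- `Spin^ℂ(r, s) = (Spin(r, s) × U(1)) / {(1, 1), (-1, -1)}`. -/
abbrev SpinC (r s : ℕ) : Type := (Spin r s × Circle) ⧸ signSubgroup r s

/-- The component `[(g, u)] ↦ Π(g)` of `ρ : Spin^ℂ(r, s) → SO(r, s) × U(1)`. -/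
def spinCCover (r s : ℕ) : SpinC r s →* (SigSpace r s ≃ₗ[ℝ] SigSpace r s) :=
  QuotientGroup.lift (signSubgroup r s) ((spinCover r s).comp (MonoidHom.fst _ _)) (by
    rintro a (⟨h, -⟩ | ⟨h, -⟩)
    · have h1 : a.1 = 1 := Subtype.ext h
      simp [h1]
    · ext1 v
      refine vec_injective ?_
      refine (vec_coverFun a.1 v).trans ?_
      simp [h, inv_neg])

/-- The component `[(g, u)] ↦ u²` of `ρ : Spin^ℂ(r, s) → SO(r, s) × U(1)`. -/
def spinCDet (r s : ℕ) : SpinC r s →* Circle :=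
  QuotientGroup.lift (signSubgroup r s) ((powMonoidHom 2).comp (MonoidHom.snd _ _)) (by
    rintro a (⟨-, h⟩ | ⟨-, h⟩) <;> ext <;> simp [h])

/-- `d_γ = 2^⌊D/2⌋`. -/
def dGamma (r s : ℕ) : ℕ := 2 ^ ((r + s) / 2)

/-- A choice of constant Dirac matrices: `{γ_a, γ_b} = -2 η_{ab} 𝟙`. -/
structure DiracMatrices (r s : ℕ) where
  γ : Fin r ⊕ Fin s → Matrix (Fin (dGamma r s)) (Fin (dGamma r s)) ℂ
  clifford : ∀ a b, γ a * γ b + γ b * γ a = (-(2 * if a = b then sgn a else 0) : ℝ) • 1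

namespace DiracMatrices

variable {r s : ℕ} (Γ : DiracMatrices r s)

/-- `γ(v) = v^a γ_a`. -/
def lin : SigSpace r s →ₗ[ℝ] Matrix (Fin (dGamma r s)) (Fin (dGamma r s)) ℂ :=
  Fintype.linearCombination ℝ Γ.γ

theorem lin_mul_self (v : SigSpace r s) : Γ.lin v * Γ.lin v = algebraMap ℝ _ (cliffordForm r s v) := by
  have h1 : Γ.lin v * Γ.lin v = ∑ a, ∑ b, (v a * v b) • (Γ.γ a * Γ.γ b) := by
    simp only [lin, Fintype.linearCombination_apply, Finset.sum_mul_sum, smul_mul_smul_comm]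
  have h2 : Γ.lin v * Γ.lin v = ∑ a, ∑ b, (v a * v b) • (Γ.γ b * Γ.γ a) := by
    rw [h1, Finset.sum_comm]
    simp only [mul_comm]
  have h3 : (2 : ℝ) • (Γ.lin v * Γ.lin v) = (2 : ℝ) • algebraMap ℝ _ (cliffordForm r s v) := by
    rw [two_smul]
    nth_rewrite 1 [h1]
    rw [h2, ← Finset.sum_add_distrib]
    simp only [← Finset.sum_add_distrib, ← smul_add, Γ.clifford, smul_smul]
    rw [cliffordForm_apply, Algebra.algebraMap_eq_smul_one, smul_smul]
    simp only [← Finset.sum_smul]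
    congr 1
    simp only [mul_ite, mul_neg, eta, mul_zero, Finset.sum_ite_eq, Finset.mem_univ, if_true,
      neg_ite, neg_zero, Finset.mul_sum, ← Finset.sum_neg_distrib]
    refine Finset.sum_congr rfl fun a _ => by ring
  exact smul_right_injective _ (two_ne_zero (α := ℝ)) h3

/-- The representation of the Clifford algebra given by the Dirac matrices. -/
def cliffordRep : Cl r s →ₐ[ℝ] Matrix (Fin (dGamma r s)) (Fin (dGamma r s)) ℂ :=
  CliffordAlgebra.lift (cliffordForm r s) ⟨Γ.lin, Γ.lin_mul_self⟩

/-- The spin representation `Spin(r, s) → GL(d_γ, ℂ)` given by the Dirac matrices. -/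
def spinRep : Spin r s →* GL (Fin (dGamma r s)) ℂ :=
  (Units.map (Γ.cliffordRep : Cl r s →* _)).comp (Spin r s).subtype

/-- The representation `[(g, u)] ↦ u · g` of `Spin^ℂ(r, s)` given by the Dirac matrices. -/
def spinCRep : SpinC r s →* GL (Fin (dGamma r s)) ℂ :=
  QuotientGroup.lift (signSubgroup r s)
    { toFun := fun p => Units.map ((algebraMap ℂ (Matrix (Fin (dGamma r s)) (Fin (dGamma r s)) ℂ) :
          ℂ →+* Matrix (Fin (dGamma r s)) (Fin (dGamma r s)) ℂ) : ℂ →* _) (Circle.toUnits p.2) *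
        Γ.spinRep p.1
      map_one' := by simp
      map_mul' := fun p q => by
        ext1
        simp only [Prod.fst_mul, Prod.snd_mul, map_mul, Units.val_mul, Units.coe_map,
          MonoidHom.coe_coe, mul_assoc]
        congr 1
        rw [← mul_assoc, ← mul_assoc, Algebra.commutes] } (by
    rintro a (⟨h, h'⟩ | ⟨h, h'⟩)
    · ext1
      simp [spinRep, h, h']
    · ext1
      simp [spinRep, h, h'])

end DiracMatrices

/-! ### Smooth principal bundles and associated vector bundles -/

section Bundles

universe u w w'

open TopologicalSpace (Opens)

/-- The notion of a smooth map from (open subsets of) the `n`-manifold `M` to the Lie group `G`. -/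
class SmoothTarget (n : ℕ) (M : Type u) [TopologicalSpace M]
    [ChartedSpace (EuclideanSpace ℝ (Fin n)) M] (G : Type*) where
  SmoothOn : (M → G) → Set M → Prop
  mono : ∀ {h : M → G} {U V : Set M}, SmoothOn h U → V ⊆ U → SmoothOn h V

variable {n : ℕ} {M : Type u} [TopologicalSpace M] [ChartedSpace (EuclideanSpace ℝ (Fin n)) M]

/-- Smoothness of a map to a finite-dimensional real vector space `A`: all its components, i.e. its
compositions with linear functionals, are smooth. -/
def LinSmoothOn (n : ℕ) {M : Type u} [TopologicalSpace M]
    [ChartedSpace (EuclideanSpace ℝ (Fin n)) M] {A : Type*} [AddCommGroup A] [Module ℝ A]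
    (f : M → A) (U : Set M) : Prop :=
  ∀ ℓ : A →ₗ[ℝ] ℝ, ContMDiffOn (𝓡 n) 𝓘(ℝ) ∞ (fun x => ℓ (f x)) U

/-- `Spin(r, s)` is an embedded Lie subgroup of the units of the Clifford algebra. -/
instance (r s : ℕ) : SmoothTarget n M (Spin r s) where
  SmoothOn h U := LinSmoothOn n (fun x => ((h x : (Cl r s)ˣ) : Cl r s)) U
  mono h hUV ℓ := (h ℓ).mono hUV

/-- `U(1)` is an embedded Lie subgroup of `ℂˣ`. -/
instance : SmoothTarget n M Circle where
  SmoothOn h U := LinSmoothOn n (fun x => (h x : ℂ)) U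
  mono h hUV ℓ := (h ℓ).mono hUV

/-- `Spin^ℂ(r, s)` carries the smooth structure for which the two-fold covering map
`Spin(r, s) × U(1) → Spin^ℂ(r, s)` is a local diffeomorphism: a map to `Spin^ℂ(r, s)` is smooth iff
it lifts locally to a smooth map to `Spin(r, s) × U(1)`. -/
instance (r s : ℕ) : SmoothTarget n M (SpinC r s) where
  SmoothOn h U := ∀ x ∈ U, ∃ W : Set M, IsOpen W ∧ x ∈ W ∧ ∃ (a : M → Spin r s) (b : M → Circle),
    SmoothTarget.SmoothOn n a (U ∩ W) ∧ SmoothTarget.SmoothOn n b (U ∩ W) ∧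
      ∀ y ∈ U ∩ W, h y = QuotientGroup.mk (a y, b y)
  mono h hUV x hx := by
    obtain ⟨W, hW, hxW, a, b, ha, hb, hab⟩ := h x (hUV hx)
    have hsub := Set.inter_subset_inter_left W hUV
    exact ⟨W, hW, hxW, a, b, SmoothTarget.mono ha hsub, SmoothTarget.mono hb hsub,
      fun y hy => hab y (hsub hy)⟩

/-- `GL(d, ℂ)` is open in the space of matrices. -/
instance (d : ℕ) : SmoothTarget n M (GL (Fin d) ℂ) where
  SmoothOn h U := LinSmoothOn n (fun x => (h x : Matrix (Fin d) (Fin d) ℂ)) U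
  mono h hUV ℓ := (h ℓ).mono hUV

/-- `GL(D, ℝ)` is open in the space of matrices. -/
instance (r s : ℕ) : SmoothTarget n M (GL (Fin r ⊕ Fin s) ℝ) where
  SmoothOn h U := LinSmoothOn n (fun x => (h x : Matrix (Fin r ⊕ Fin s) (Fin r ⊕ Fin s) ℝ)) U
  mono h hUV ℓ := (h ℓ).mono hUV

instance (G H : Type*) [SmoothTarget n M G] [SmoothTarget n M H] : SmoothTarget n M (G × H) where
  SmoothOn h U := SmoothTarget.SmoothOn n (fun x => (h x).1) U ∧
    SmoothTarget.SmoothOn n (fun x => (h x).2) U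
  mono h hUV := ⟨SmoothTarget.mono h.1 hUV, SmoothTarget.mono h.2 hUV⟩

/-- A smooth principal `G`-bundle over the `n`-manifold `M`: a family of fibres with a free and
transitive right action of `G` on each fibre, and an atlas of local sections `(U, σ)` over open sets
covering `M` (only the values of `σ` on `U` matter) whose transition functions are smooth.
The total space carries the unique topology and smooth structure for which the local trivializations
`(x, g) ↦ σ(x) g` over `U` are diffeomorphisms. -/
structure PrincipalBundle (n : ℕ) (M : Type u) [TopologicalSpace M]
    [ChartedSpace (EuclideanSpace ℝ (Fin n)) M] (G : Type*) [Group G] [SmoothTarget n M G] where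
  Fiber : M → Type w
  act : ∀ {x : M}, Fiber x → G → Fiber x
  act_one : ∀ {x : M} (p : Fiber x), act p 1 = p
  act_mul : ∀ {x : M} (p : Fiber x) (g h : G), act p (g * h) = act (act p g) h
  existsUnique_act : ∀ {x : M} (p q : Fiber x), ∃! g : G, act p g = q
  atlas : Set (Opens M × ∀ x : M, Fiber x)
  cover : ∀ x : M, ∃ σ ∈ atlas, x ∈ σ.1
  smooth_transition : ∀ σ ∈ atlas, ∀ τ ∈ atlas, ∃ h : M → G,
    (∀ x ∈ (σ.1 : Set M) ∩ τ.1, act (σ.2 x) (h x) = τ.2 x) ∧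
      SmoothTarget.SmoothOn n h ((σ.1 : Set M) ∩ τ.1)

namespace PrincipalBundle

variable {G : Type*} [Group G] [SmoothTarget n M G]

/-- A section of `P` which is smooth over the open set `U`. -/
def IsSmoothSectionOn (P : PrincipalBundle.{u, w} n M G) (U : Set M) (τ : ∀ x, P.Fiber x) : Prop :=
  ∀ σ ∈ P.atlas, ∃ h : M → G, (∀ x ∈ (σ.1 : Set M) ∩ U, P.act (σ.2 x) (h x) = τ x) ∧
    SmoothTarget.SmoothOn n h ((σ.1 : Set M) ∩ U)

/-- The fibre product `P ×_M Q`, a principal `G × H`-bundle. -/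
def fiberProd {H : Type*} [Group H] [SmoothTarget n M H] (P : PrincipalBundle.{u, w} n M G)
    (Q : PrincipalBundle.{u, w'} n M H) : PrincipalBundle.{u, max w w'} n M (G × H) where
  Fiber x := P.Fiber x × Q.Fiber x
  act p g := (P.act p.1 g.1, Q.act p.2 g.2)
  act_one p := by simp [P.act_one, Q.act_one]
  act_mul p g h := by simp [P.act_mul, Q.act_mul]
  existsUnique_act p q := by
    obtain ⟨g, hg, hg'⟩ := P.existsUnique_act p.1 q.1
    obtain ⟨h, hh, hh'⟩ := Q.existsUnique_act p.2 q.2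
    refine ⟨(g, h), Prod.ext hg hh, fun k hk => Prod.ext (hg' _ ?_) (hh' _ ?_)⟩
    · exact congrArg Prod.fst hk
    · exact congrArg Prod.snd hk
  atlas := {σ | ∃ α ∈ P.atlas, ∃ β ∈ Q.atlas, σ = (α.1 ⊓ β.1, fun x => (α.2 x, β.2 x))}
  cover x := by
    obtain ⟨α, hα, hx⟩ := P.cover x
    obtain ⟨β, hβ, hx'⟩ := Q.cover x
    exact ⟨_, ⟨α, hα, β, hβ, rfl⟩, hx, hx'⟩
  smooth_transition := by
    rintro _ ⟨α, hα, β, hβ, rfl⟩ _ ⟨α', hα', β', hβ', rfl⟩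
    obtain ⟨h, hh, hs⟩ := P.smooth_transition α hα α' hα'
    obtain ⟨k, hk, hs'⟩ := Q.smooth_transition β hβ β' hβ'
    refine ⟨fun x => (h x, k x), fun x hx => ?_, SmoothTarget.mono hs ?_, SmoothTarget.mono hs' ?_⟩
    · exact Prod.ext (hh x ⟨hx.1.1, hx.2.1⟩) (hk x ⟨hx.1.2, hx.2.2⟩)
    · exact fun x hx => ⟨hx.1.1, hx.2.1⟩
    · exact fun x hx => ⟨hx.1.2, hx.2.2⟩

end PrincipalBundle

/-- A smooth representation of the Lie group `G` on the complex vector space `F`: it turns smooth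
`G`-valued maps into smooth operator-valued maps. -/
structure SmoothRep (n : ℕ) (M : Type u) [TopologicalSpace M]
    [ChartedSpace (EuclideanSpace ℝ (Fin n)) M] (G : Type*) [Group G] [SmoothTarget n M G]
    (F : Type*) [NormedAddCommGroup F] [NormedSpace ℂ F] where
  rep : G →* (F →L[ℂ] F)
  smooth : ∀ (h : M → G) (U : Set M), SmoothTarget.SmoothOn n h U →
    ContMDiffOn (𝓡 n) 𝓘(ℝ, F →L[ℂ] F) ∞ (fun x => rep (h x)) U

variable {G : Type*} [Group G] [SmoothTarget n M G]
  {F : Type w'} [NormedAddCommGroup F] [NormedSpace ℂ F]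

theorem SmoothRep.inv_rep (ρ : SmoothRep n M G F) (g : G) (v : F) :
    ρ.rep g⁻¹ (ρ.rep g v) = v := by
  change (ρ.rep g⁻¹ * ρ.rep g) v = v
  rw [← map_mul]; simp

theorem SmoothRep.rep_inv (ρ : SmoothRep n M G F) (g : G) (v : F) :
    ρ.rep g (ρ.rep g⁻¹ v) = v := by
  change (ρ.rep g * ρ.rep g⁻¹) v = v
  rw [← map_mul]; simp

/-- The equivalence relation `(p, v) ∼ (p g, ρ(g)⁻¹ v)` on `P_x × F`. -/
def assocSetoid (P : PrincipalBundle.{u, w} n M G) (ρ : SmoothRep n M G F) (x : M) :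
    Setoid (P.Fiber x × F) where
  r a b := ∃ g : G, b = (P.act a.1 g, ρ.rep g⁻¹ a.2)
  iseqv :=
    { refl := fun a => ⟨1, by simp [P.act_one]⟩
      symm := by
        rintro a b ⟨g, rfl⟩
        exact ⟨g⁻¹, by simp [← P.act_mul, P.act_one, ρ.rep_inv]⟩
      trans := by
        rintro a b c ⟨g, rfl⟩ ⟨h, rfl⟩
        exact ⟨g * h, by simp [P.act_mul]⟩ }

/-- The fibre over `x` of the associated bundle `P ×_ρ F = (P × F) / ∼`. -/
def Assoc (P : PrincipalBundle.{u, w} n M G) (ρ : SmoothRep n M G F) (x : M) : Type (max w w') :=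
  Quotient (assocSetoid P ρ x)

namespace Assoc

variable (P : PrincipalBundle.{u, w} n M G) (ρ : SmoothRep n M G F) {x : M}

/-- The class `[p, v]`. -/
def mk (p : P.Fiber x) (v : F) : Assoc P ρ x := Quotient.mk (assocSetoid P ρ x) (p, v)

theorem mk_act (p : P.Fiber x) (g : G) (v : F) : mk P ρ (P.act p g) v = mk P ρ p (ρ.rep g v) :=
  (Quotient.sound (s := assocSetoid P ρ x) ⟨g, by simp [ρ.inv_rep]⟩).symm

theorem mk_bijective (p : P.Fiber x) : Function.Bijective (mk P ρ p) := by
  constructor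
  · intro v w h
    obtain ⟨g, hg⟩ := Quotient.exact (s := assocSetoid P ρ x) h
    have h1 : P.act p g = p := (congrArg Prod.fst hg).symm
    have h2 : g = 1 := (P.existsUnique_act p p).unique h1 (P.act_one p)
    simpa [h2] using (congrArg Prod.snd hg).symm
  · intro e
    obtain ⟨⟨q, v⟩, rfl⟩ := Quotient.exists_rep e
    obtain ⟨g, rfl, -⟩ := P.existsUnique_act p q
    exact ⟨ρ.rep g v, (mk_act P ρ p g v).symm⟩

/-- The bijection `v ↦ [p, v]` given by a frame `p`. -/
def frame (p : P.Fiber x) : F ≃ Assoc P ρ x := Equiv.ofBijective _ (mk_bijective P ρ p)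

/-- An auxiliary frame; nothing below depends on its choice, see `frameL`. -/
def someFrame (x : M) : P.Fiber x := (P.cover x).choose.2 x

instance : AddCommGroup (Assoc P ρ x) := (frame P ρ (someFrame P x)).symm.addCommGroup

instance : Module ℂ (Assoc P ρ x) := (frame P ρ (someFrame P x)).symm.module ℂ

instance : TopologicalSpace (Assoc P ρ x) :=
  TopologicalSpace.induced (frame P ρ (someFrame P x)).symm inferInstance

/-- The auxiliary frame as a linear homeomorphism. -/
def someFrameL (x : M) : F ≃L[ℂ] Assoc P ρ x :=
  let e : Assoc P ρ x ≃ₗ[ℂ] F := (frame P ρ (someFrame P x)).symm.linearEquiv ℂ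
  { e.symm with
    continuous_toFun := continuous_induced_rng.2 (by
      convert continuous_id
      ext v
      exact (frame P ρ (someFrame P x)).symm_apply_apply v)
    continuous_invFun := continuous_induced_dom }

instance : IsTopologicalAddGroup (Assoc P ρ x) :=
  topologicalAddGroup_induced ((someFrameL P ρ x).symm : Assoc P ρ x →ₗ[ℂ] F)

instance : ContinuousSMul ℂ (Assoc P ρ x) :=
  continuousSMul_induced ((someFrameL P ρ x).symm : Assoc P ρ x →ₗ[ℂ] F)

/-- `ρ(g)` as an automorphism of `F`. -/
def repL (g : G) : F ≃L[ℂ] F :=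
  ContinuousLinearEquiv.equivOfInverse (ρ.rep g) (ρ.rep g⁻¹) (ρ.inv_rep g) (ρ.rep_inv g)

/-- Every frame `p` gives a linear homeomorphism `v ↦ [p, v]`. -/
def frameL (p : P.Fiber x) : F ≃L[ℂ] Assoc P ρ x :=
  (repL ρ (P.existsUnique_act (someFrame P x) p).choose).trans (someFrameL P ρ x)

@[simp] theorem frameL_apply (p : P.Fiber x) (v : F) : frameL P ρ p v = mk P ρ p v := by
  have h := (P.existsUnique_act (someFrame P x) p).choose_spec.1
  conv_rhs => rw [← h]
  exact (mk_act P ρ _ _ v).symm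

/-- The local trivialization `[σ(x), v] ↦ (x, v)` given by a local section `σ`. -/
def pretriv (σ : Opens M × ∀ x, P.Fiber x) :
    Bundle.Pretrivialization F (Bundle.TotalSpace.proj : Bundle.TotalSpace F (Assoc P ρ) → M) where
  toFun z := (z.1, (frameL P ρ (σ.2 z.1)).symm z.2)
  invFun y := ⟨y.1, frameL P ρ (σ.2 y.1) y.2⟩
  source := Bundle.TotalSpace.proj ⁻¹' σ.1
  target := (σ.1 : Set M) ×ˢ Set.univ
  map_source' z hz := ⟨hz, trivial⟩
  map_target' y hy := hy.1
  left_inv' z _ := by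
    rcases z with ⟨x, e⟩
    exact congrArg (Bundle.TotalSpace.mk x) ((frameL P ρ (σ.2 x)).apply_symm_apply e)
  right_inv' y _ := Prod.ext rfl ((frameL P ρ (σ.2 y.1)).symm_apply_apply y.2)
  open_target := σ.1.isOpen.prod isOpen_univ
  baseSet := σ.1
  open_baseSet := σ.1.isOpen
  source_eq := rfl
  target_eq := rfl
  proj_toFun _ _ := rfl

theorem pretriv_symm (σ : Opens M × ∀ x, P.Fiber x) {x : M} (hx : x ∈ σ.1) (v : F) :
    (pretriv P ρ σ).symm x v = mk P ρ (σ.2 x) v := by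
  rw [Bundle.Pretrivialization.symm_apply (pretriv P ρ σ) hx]
  exact frameL_apply P ρ _ v

theorem coordChange_aux {σ τ : Opens M × ∀ x, P.Fiber x} {h : M → G} {x : M}
    (hx : x ∈ (τ.1 : Set M) ∩ σ.1) (hh : P.act (σ.2 x) (h x) = τ.2 x) (v : F) :
    ρ.rep (h x) v = ((pretriv P ρ σ) ⟨x, (pretriv P ρ τ).symm x v⟩).2 := by
  rw [pretriv_symm P ρ τ hx.1]
  change _ = (frameL P ρ (σ.2 x)).symm _
  rw [← hh, mk_act, ← frameL_apply, ContinuousLinearEquiv.symm_apply_apply]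

/-- The restriction of scalars from complex to real operators. -/
abbrev restrictL : (F →L[ℂ] F) →L[ℝ] (F →L[ℝ] F) := ContinuousLinearMap.restrictScalarsL ℂ F F ℝ ℝ

theorem exists_smooth_coordChange {σ τ : Opens M × ∀ x, P.Fiber x} (hσ : σ ∈ P.atlas)
    (hτ : τ ∈ P.atlas) : ∃ f : M → F →L[ℂ] F,
      ContMDiffOn (𝓡 n) 𝓘(ℝ, F →L[ℂ] F) ∞ f ((pretriv P ρ σ).baseSet ∩ (pretriv P ρ τ).baseSet) ∧
      ∀ x ∈ (pretriv P ρ σ).baseSet ∩ (pretriv P ρ τ).baseSet, ∀ v : F,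
        f x v = ((pretriv P ρ τ) ⟨x, (pretriv P ρ σ).symm x v⟩).2 := by
  obtain ⟨h, hh, hs⟩ := P.smooth_transition τ hτ σ hσ
  exact ⟨fun x => ρ.rep (h x), ρ.smooth h _ (SmoothTarget.mono hs fun x hx => ⟨hx.2, hx.1⟩),
    fun x hx v => coordChange_aux P ρ hx (hh x ⟨hx.2, hx.1⟩) v⟩

/-- The smooth structure on `P ×_ρ F` given by the local sections of `P`. -/
def prebundle : VectorPrebundle ℝ F (Assoc P ρ) where
  pretrivializationAtlas := {e | ∃ σ ∈ P.atlas, e = pretriv P ρ σ}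
  pretrivialization_linear' := by
    rintro _ ⟨σ, -, rfl⟩
    exact ⟨fun x _ => (((frameL P ρ (σ.2 x)).symm.toLinearEquiv.restrictScalars ℝ).toLinearMap).isLinear⟩
  pretrivializationAt x := pretriv P ρ (P.cover x).choose
  mem_base_pretrivializationAt x := (P.cover x).choose_spec.2
  pretrivialization_mem_atlas x := ⟨_, (P.cover x).choose_spec.1, rfl⟩
  exists_coordChange := by
    rintro _ ⟨σ, hσ, rfl⟩ _ ⟨τ, hτ, rfl⟩
    obtain ⟨f, hf, hf'⟩ := exists_smooth_coordChange P ρ hσ hτ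
    exact ⟨fun x => (f x).restrictScalars ℝ, restrictL.continuous.comp_continuousOn hf.continuousOn,
      fun x hx v => hf' x hx v⟩
  totalSpaceMk_isInducing x := Topology.isInducing_const_prod.mpr
    ((frameL P ρ ((P.cover x).choose.2 x)).symm.toHomeomorph.isInducing)

instance : (prebundle P ρ).IsContMDiff (𝓡 n) ∞ where
  exists_contMDiffCoordChange := by
    rintro _ ⟨σ, hσ, rfl⟩ _ ⟨τ, hτ, rfl⟩
    obtain ⟨f, hf, hf'⟩ := exists_smooth_coordChange P ρ hσ hτ
    exact ⟨fun x => (f x).restrictScalars ℝ, restrictL.contMDiff.comp_contMDiffOn hf,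
      fun x hx v => hf' x hx v⟩

instance : TopologicalSpace (Bundle.TotalSpace F (Assoc P ρ)) := (prebundle P ρ).totalSpaceTopology

instance : FiberBundle F (Assoc P ρ) := (prebundle P ρ).toFiberBundle

/-- `P ×_ρ F` is a smooth vector bundle ... -/
instance : VectorBundle ℝ F (Assoc P ρ) := (prebundle P ρ).toVectorBundle

instance : ContMDiffVectorBundle ∞ F (Assoc P ρ) (𝓡 n) :=
  VectorPrebundle.contMDiffVectorBundle (IB := 𝓡 n) (n := ∞) (prebundle P ρ)

/-- ... and its local trivializations are complex linear. -/
instance : VectorBundle ℂ F (Assoc P ρ) where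
  trivialization_linear' := by
    rintro _ ⟨_, ⟨σ, -, rfl⟩, rfl⟩
    exact ⟨fun x _ => ((frameL P ρ (σ.2 x)).symm.toLinearEquiv.toLinearMap).isLinear⟩
  continuousOn_coordChange' := by
    rintro _ _ ⟨_, ⟨σ, hσ, rfl⟩, rfl⟩ ⟨_, ⟨τ, hτ, rfl⟩, rfl⟩
    obtain ⟨f, hf, hf'⟩ := exists_smooth_coordChange P ρ hσ hτ
    refine hf.continuousOn.congr fun x hx => ?_
    ext v
    refine Eq.trans ?_ (hf' x hx v).symm
    rw [ContinuousLinearEquiv.coe_coe, Bundle.Trivialization.coordChangeL_apply]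
    exacts [rfl, hx]

end Assoc

end Bundles

/-! ### The bundle of complex endomorphisms -/

section EndBundle

variable {n : ℕ} {M : Type*} [TopologicalSpace M] [ChartedSpace (EuclideanSpace ℝ (Fin n)) M]

/-- A family of operators on a finite-dimensional space is smooth if all its values are. -/
theorem contMDiffOn_clm_of_apply {𝕜 : Type*} [RCLike 𝕜] {F F' : Type*} [NormedAddCommGroup F]
    [NormedSpace 𝕜 F] [FiniteDimensional 𝕜 F] [NormedAddCommGroup F'] [NormedSpace 𝕜 F']
    [NormedSpace ℝ F'] [IsScalarTower ℝ 𝕜 F'] [SMulCommClass 𝕜 ℝ F']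
    {f : M → F →L[𝕜] F'} {U : Set M}
    (h : ∀ v, ContMDiffOn (𝓡 n) 𝓘(ℝ, F') ∞ (fun x => f x v) U) :
    ContMDiffOn (𝓡 n) 𝓘(ℝ, F →L[𝕜] F') ∞ f U := by
  let b := Module.finBasis 𝕜 F
  let c : Fin (Module.finrank 𝕜 F) → F →L[𝕜] 𝕜 := fun i => LinearMap.toContinuousLinearMap (b.coord i)
  have hf : f = fun x => ∑ i, ContinuousLinearMap.smulRight (c i) (f x (b i)) := by
    funext x
    ext v
    conv_lhs => rw [← b.sum_repr v]
    simp only [map_sum, map_smul]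
    rw [sum_apply]
    rfl
  rw [hf]
  refine contMDiffOn_finsetSum fun i _ => ?_
  exact (((ContinuousLinearMap.smulRightL 𝕜 F F' (c i)).restrictScalars ℝ).contMDiff).comp_contMDiffOn (h (b i))

/-- The operator `L ↦ c(b, c(L, a))` for a bilinear map `c`. -/
def bilinConj {R : Type*} [NormedAddCommGroup R] [NormedSpace ℝ R] (c : R →L[ℝ] R →L[ℝ] R)
    (a b : R) : R →L[ℝ] R :=
  (c b).comp (c.flip a)

theorem bilin_continuous {R : Type*} [NormedAddCommGroup R] [NormedSpace ℝ R] (c : R →L[ℝ] R →L[ℝ] R)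
    {A B : M → R} {U : Set M} (hA : ContinuousOn A U) (hB : ContinuousOn B U) :
    ContinuousOn (fun x => bilinConj c (A x) (B x)) U :=
  (c.continuous.comp_continuousOn hB).clm_comp (c.flip.continuous.comp_continuousOn hA)

theorem bilin_smooth {R : Type*} [NormedAddCommGroup R] [NormedSpace ℝ R] (c : R →L[ℝ] R →L[ℝ] R)
    {A B : M → R} {U : Set M} (hA : ContMDiffOn (𝓡 n) 𝓘(ℝ, R) ∞ A U)
    (hB : ContMDiffOn (𝓡 n) 𝓘(ℝ, R) ∞ B U) :
    ContMDiffOn (𝓡 n) 𝓘(ℝ, R →L[ℝ] R) ∞ (fun x => bilinConj c (A x) (B x)) U :=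
  (c.contMDiff.comp_contMDiffOn hB).clm_comp (c.flip.contMDiff.comp_contMDiffOn hA)

variable {F : Type*} [NormedAddCommGroup F] [NormedSpace ℂ F]
  {E : M → Type*} [∀ x, AddCommGroup (E x)] [∀ x, Module ℂ (E x)] [∀ x, TopologicalSpace (E x)]
  [TopologicalSpace (Bundle.TotalSpace F E)] [FiberBundle F E] [VectorBundle ℂ F E]

/-- Composition of complex operators as a real bilinear map. -/
def compR : (F →L[ℂ] F) →L[ℝ] (F →L[ℂ] F) →L[ℝ] (F →L[ℂ] F) :=
  LinearMap.mkContinuous₂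
    (LinearMap.mk₂ ℝ (fun A B : F →L[ℂ] F => A.comp B) (fun _ _ _ => by ext; simp)
      (fun _ _ _ => by ext; simp) (fun _ _ _ => by ext; simp) (fun c A B => by
        ext v; simp)) 1
    (fun A B => by simpa using ContinuousLinearMap.opNorm_comp_le A B)

/-- The operator `L ↦ B ∘ L ∘ A`. -/
def conjL (A B : F →L[ℂ] F) : (F →L[ℂ] F) →L[ℝ] (F →L[ℂ] F) :=
  bilinConj compR A B

theorem conjL_apply (A B L : F →L[ℂ] F) : conjL A B L = B.comp (L.comp A) := rfl

theorem conjL_continuous {A B : M → F →L[ℂ] F} {U : Set M} (hA : ContinuousOn A U)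
    (hB : ContinuousOn B U) : ContinuousOn (fun x => conjL (A x) (B x)) U :=
  bilin_continuous (R := F →L[ℂ] F) compR hA hB

theorem conjL_smooth {A B : M → F →L[ℂ] F} {U : Set M}
    (hA : ContMDiffOn (𝓡 n) 𝓘(ℝ, F →L[ℂ] F) ∞ A U) (hB : ContMDiffOn (𝓡 n) 𝓘(ℝ, F →L[ℂ] F) ∞ B U) :
    ContMDiffOn (𝓡 n) 𝓘(ℝ, (F →L[ℂ] F) →L[ℝ] (F →L[ℂ] F)) ∞ (fun x => conjL (A x) (B x)) U :=
  bilin_smooth (R := F →L[ℂ] F) compR hA hB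

/-- Real scalars act continuously on complex operators. -/
instance continuousSMul_clm {X Y : Type*} [AddCommGroup X] [Module ℂ X] [TopologicalSpace X]
    [AddCommGroup Y] [Module ℂ Y] [TopologicalSpace Y] [IsTopologicalAddGroup Y]
    [ContinuousSMul ℂ Y] : ContinuousSMul ℝ (X →L[ℂ] Y) :=
  IsScalarTower.continuousSMul ℂ

variable [∀ x, IsTopologicalAddGroup (E x)] [∀ x, ContinuousSMul ℂ (E x)]

open Bundle

theorem end_coordChange {e₁ e₂ e₁' e₂' : Trivialization F (π F E)} [MemTrivializationAtlas e₁]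
    [MemTrivializationAtlas e₂] [MemTrivializationAtlas e₁'] [MemTrivializationAtlas e₂']
    [(Trivialization.continuousLinearMap (RingHom.id ℂ) e₁ e₂).IsLinear ℝ]
    [(Trivialization.continuousLinearMap (RingHom.id ℂ) e₁' e₂').IsLinear ℝ] {x : M}
    (hx : x ∈ (e₁.baseSet ∩ e₂.baseSet) ∩ (e₁'.baseSet ∩ e₂'.baseSet)) :
    ((Trivialization.coordChangeL ℝ (Trivialization.continuousLinearMap (RingHom.id ℂ) e₁ e₂)
      (Trivialization.continuousLinearMap (RingHom.id ℂ) e₁' e₂') x :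
      (F →L[ℂ] F) ≃L[ℝ] (F →L[ℂ] F)) : (F →L[ℂ] F) →L[ℝ] (F →L[ℂ] F)) =
    conjL (e₁'.coordChangeL ℂ e₁ x : F →L[ℂ] F) (e₂.coordChangeL ℂ e₂' x : F →L[ℂ] F) := by
  have h := Pretrivialization.continuousLinearMapCoordChange_apply (RingHom.id ℂ) e₁ e₁' e₂ e₂' x hx
  ext1 L
  refine Eq.trans ?_ ((h L).symm.trans ?_)
  · rw [ContinuousLinearEquiv.coe_coe, Trivialization.coordChangeL_apply]
    exacts [rfl, hx]
  · rfl

theorem end_isLinear (e : Trivialization (F →L[ℂ] F) (π (F →L[ℂ] F) (fun x => E x →L[ℂ] E x)))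
    [MemTrivializationAtlas e] : e.IsLinear ℝ := by
  have := VectorBundle.trivialization_linear' (R := ℂ) e
  exact ⟨fun x hx => ((this.linear x hx).mk' _ |>.restrictScalars ℝ).isLinear⟩

/-- `End(E)`, with fibres `End_ℂ(E_x)`, is a real vector bundle ... -/
instance endVectorBundle : VectorBundle ℝ (F →L[ℂ] F) (fun x => E x →L[ℂ] E x) where
  trivialization_linear' e _ := end_isLinear e
  continuousOn_coordChange' := by
    rintro _ _ ⟨_, ⟨e₁, e₂, h₁, h₂, rfl⟩, rfl⟩ ⟨_, ⟨e₁', e₂', h₁', h₂', rfl⟩, rfl⟩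
    have := end_isLinear (Trivialization.continuousLinearMap (RingHom.id ℂ) e₁ e₂)
    have := end_isLinear (Trivialization.continuousLinearMap (RingHom.id ℂ) e₁' e₂')
    refine ContinuousOn.congr ?_ fun x hx => end_coordChange hx
    exact conjL_continuous ((VectorBundle.continuousOn_coordChange' (R := ℂ) e₁' e₁).mono
        fun x hx => ⟨hx.2.1, hx.1.1⟩)
      ((VectorBundle.continuousOn_coordChange' (R := ℂ) e₂ e₂').mono fun x hx => ⟨hx.1.2, hx.2.2⟩)

variable [FiniteDimensional ℂ F] [VectorBundle ℝ F E] [ContMDiffVectorBundle ∞ F E (𝓡 n)]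

theorem contMDiffOn_coordChange_complex (e e' : Trivialization F (π F E)) [MemTrivializationAtlas e]
    [MemTrivializationAtlas e'] :
    ContMDiffOn (𝓡 n) 𝓘(ℝ, F →L[ℂ] F) ∞ (fun x => (e.coordChangeL ℂ e' x : F →L[ℂ] F))
      (e.baseSet ∩ e'.baseSet) := by
  refine contMDiffOn_clm_of_apply fun v => ?_
  have h := ContMDiffVectorBundle.contMDiffOn_coordChangeL (n := ∞) (IB := 𝓡 n) (F := F) (E := E) e e'
  refine (h.clm_apply (contMDiffOn_const (c := v))).congr fun x hx => ?_
  rw [ContinuousLinearEquiv.coe_coe, ContinuousLinearEquiv.coe_coe,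
    Trivialization.coordChangeL_apply _ _ hx, Trivialization.coordChangeL_apply _ _ hx]

/-- ... which is smooth. -/
instance endContMDiffVectorBundle :
    ContMDiffVectorBundle ∞ (F →L[ℂ] F) (fun x => E x →L[ℂ] E x) (𝓡 n) where
  contMDiffOn_coordChangeL := by
    rintro _ _ ⟨_, ⟨e₁, e₂, h₁, h₂, rfl⟩, rfl⟩ ⟨_, ⟨e₁', e₂', h₁', h₂', rfl⟩, rfl⟩
    refine ContMDiffOn.congr ?_ fun x hx => end_coordChange hx
    refine conjL_smooth ((contMDiffOn_coordChange_complex e₁' e₁).mono fun x hx => ⟨hx.2.1, hx.1.1⟩)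
      ((contMDiffOn_coordChange_complex e₂ e₂').mono fun x hx => ⟨hx.1.2, hx.2.2⟩)

end EndBundle

/-! ### Pseudo-Riemannian manifolds, frames, `Spin` and `Spin^ℂ` structures -/

section Geometry

open Bundle

universe u w w'

variable {r s : ℕ} {M : Type u} [TopologicalSpace M]
  [ChartedSpace (EuclideanSpace ℝ (Fin (r + s))) M]

/-- The tangent space of the `(r + s)`-manifold `M` at `x`. -/
abbrev TSpace (r s : ℕ) {M : Type u} [TopologicalSpace M]
    [ChartedSpace (EuclideanSpace ℝ (Fin (r + s))) M] (x : M) : Type :=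
  TangentSpace (𝓡 (r + s)) x

/-- The vector field `X` is smooth on `U`. -/
def SmoothFieldOn [IsManifold (𝓡 (r + s)) ∞ M] (X : ∀ x : M, TSpace r s x) (U : Set M) : Prop :=
  ContMDiffOn (𝓡 (r + s)) (𝓡 (r + s)).tangent ∞
    (fun x => (⟨x, X x⟩ : TangentBundle (𝓡 (r + s)) M)) U

/-- A smooth pseudo-Riemannian metric of signature `(r, s)`. -/
structure PseudoRiemannianMetric (r s : ℕ) (M : Type u) [TopologicalSpace M]
    [ChartedSpace (EuclideanSpace ℝ (Fin (r + s))) M] [IsManifold (𝓡 (r + s)) ∞ M] where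
  val : ∀ x : M, TSpace r s x →L[ℝ] TSpace r s x →L[ℝ] ℝ
  symm : ∀ (x : M) (X Y : TSpace r s x), val x X Y = val x Y X
  signature : ∀ x : M, ∃ f : SigSpace r s ≃ₗ[ℝ] TSpace r s x, ∀ v w, val x (f v) (f w) = eta v w
  smooth : ContMDiff (𝓡 (r + s)) ((𝓡 (r + s)).prod 𝓘(ℝ, EuclideanSpace ℝ (Fin (r + s)) →L[ℝ]
      EuclideanSpace ℝ (Fin (r + s)) →L[ℝ] ℝ)) ∞
    (fun x => TotalSpace.mk' (EuclideanSpace ℝ (Fin (r + s)) →L[ℝ]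
      EuclideanSpace ℝ (Fin (r + s)) →L[ℝ] ℝ) (E := fun x => TSpace r s x →L[ℝ] TSpace r s x →L[ℝ] ℝ) x (val x))

/-- The orientation of `T_x M` determined by a linear frame `f : ℝ^D ≃ T_x M`. -/
def frameOrientation {x : M} (f : SigSpace r s ≃ₗ[ℝ] TSpace r s x) :
    Orientation ℝ (TSpace r s x) (Fin r ⊕ Fin s) :=
  ((Pi.basisFun ℝ (Fin r ⊕ Fin s)).map f).orientation

/-- An orientation of `M`: orientations of the tangent spaces given locally by smooth frames. -/
structure ManifoldOrientation (r s : ℕ) (M : Type u) [TopologicalSpace M]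
    [ChartedSpace (EuclideanSpace ℝ (Fin (r + s))) M] [IsManifold (𝓡 (r + s)) ∞ M] where
  orient : ∀ x : M, Orientation ℝ (TSpace r s x) (Fin r ⊕ Fin s)
  locally_frame : ∀ x₀ : M, ∃ U : Set M, IsOpen U ∧ x₀ ∈ U ∧
    ∃ f : ∀ x : M, SigSpace r s ≃ₗ[ℝ] TSpace r s x,
      (∀ v, SmoothFieldOn (fun x => f x v) U) ∧ ∀ x ∈ U, frameOrientation (f x) = orient x

variable [IsManifold (𝓡 (r + s)) ∞ M]

/-- The fibre of `SO(M)` over `x`: the positively oriented pseudo-orthonormal frames of `T_x M`,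
as linear maps `ℝ^{r,s} ≃ T_x M`. -/
structure SOFrame (g : PseudoRiemannianMetric r s M) (o : ManifoldOrientation r s M) (x : M) where
  frame : SigSpace r s ≃ₗ[ℝ] TSpace r s x
  isometry : ∀ v w, g.val x (frame v) (frame w) = eta v w
  oriented : frameOrientation frame = o.orient x

/-- A `Spin` structure: a principal `Spin(r, s)`-bundle `Spin(M)` with a smooth bundle map
`Φ : Spin(M) → SO(M)` over `M` such that `Φ(p h) = Φ(p) Π(h)`. -/
structure SpinStructure (g : PseudoRiemannianMetric r s M) (o : ManifoldOrientation r s M) where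
  bundle : PrincipalBundle.{u, w} (r + s) M (Spin r s)
  Φ : ∀ x, bundle.Fiber x → SOFrame g o x
  equivariant : ∀ x (p : bundle.Fiber x) (h : Spin r s) (v : SigSpace r s),
    (Φ x (bundle.act p h)).frame v = (Φ x p).frame (spinCover r s h v)
  smooth : ∀ σ ∈ bundle.atlas, ∀ v, SmoothFieldOn (fun x => (Φ x (σ.2 x)).frame v) (σ.1 : Set M)

/-- A `Spin^ℂ` structure: a principal `U(1)`-bundle `U₁(M)` and a principal `Spin^ℂ(r, s)`-bundle
`Spin^ℂ(M)` with a smooth bundle map `Φ^ℂ = (Φ, det) : Spin^ℂ(M) → SO(M) ×_M U₁(M)` over `M` which is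
equivariant with respect to `ρ : Spin^ℂ(r, s) → SO(r, s) × U(1)`. -/
structure SpinCStructure (g : PseudoRiemannianMetric r s M) (o : ManifoldOrientation r s M) where
  bundle : PrincipalBundle.{u, w} (r + s) M (SpinC r s)
  U₁ : PrincipalBundle.{u, w'} (r + s) M Circle
  Φ : ∀ x, bundle.Fiber x → SOFrame g o x
  det : ∀ x, bundle.Fiber x → U₁.Fiber x
  equivariant : ∀ x (p : bundle.Fiber x) (h : SpinC r s) (v : SigSpace r s),
    (Φ x (bundle.act p h)).frame v = (Φ x p).frame (spinCCover r s h v)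
  equivariant_det : ∀ x (p : bundle.Fiber x) (h : SpinC r s),
    det x (bundle.act p h) = U₁.act (det x p) (spinCDet r s h)
  smooth : ∀ σ ∈ bundle.atlas, ∀ v, SmoothFieldOn (fun x => (Φ x (σ.2 x)).frame v) (σ.1 : Set M)
  smooth_det : ∀ σ ∈ bundle.atlas, U₁.IsSmoothSectionOn (σ.1 : Set M) (fun x => det x (σ.2 x))

/-! #### The bundle of linear frames -/

/-- The linear automorphism of `ℝ^D` given by an invertible matrix. -/
def glAut : GL (Fin r ⊕ Fin s) ℝ →* (SigSpace r s ≃ₗ[ℝ] SigSpace r s) where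
  toFun A :=
    { toFun := fun v => A.val *ᵥ v
      map_add' := fun v w => Matrix.mulVec_add _ v w
      map_smul' := fun c v => Matrix.mulVec_smul _ c v
      invFun := fun v => (A⁻¹).val *ᵥ v
      left_inv := fun v => by
        change (A⁻¹).val *ᵥ (A.val *ᵥ v) = v
        rw [Matrix.mulVec_mulVec, ← Units.val_mul, inv_mul_cancel, Units.val_one, Matrix.one_mulVec]
      right_inv := fun v => by
        change A.val *ᵥ ((A⁻¹).val *ᵥ v) = v
        rw [Matrix.mulVec_mulVec, ← Units.val_mul, mul_inv_cancel, Units.val_one, Matrix.one_mulVec] }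
  map_one' := by
    ext1 v
    exact Matrix.one_mulVec v
  map_mul' A B := by
    ext1 v
    exact (Matrix.mulVec_mulVec v A.val B.val).symm

theorem glAut_apply (A : GL (Fin r ⊕ Fin s) ℝ) (v : SigSpace r s) : glAut A v = A.val *ᵥ v := rfl

theorem frame_transition_smooth {U U' : Set M} (hU : IsOpen U) (hU' : IsOpen U')
    {f f' : ∀ x : M, SigSpace r s ≃ₗ[ℝ] TSpace r s x}
    (hf : ∀ v, SmoothFieldOn (fun x => f x v) U) (hf' : ∀ v, SmoothFieldOn (fun x => f' x v) U')
    (v : SigSpace r s) :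
    ContMDiffOn (𝓡 (r + s)) 𝓘(ℝ, SigSpace r s) ∞ (fun x => (f x).symm (f' x v)) (U ∩ U') := by
  rintro x₀ ⟨hx₀, hx₀'⟩
  apply ContMDiffAt.contMDiffWithinAt
  let e := trivializationAt (EuclideanSpace ℝ (Fin (r + s)))
    (TangentSpace (𝓡 (r + s)) : M → Type) x₀
  have he : x₀ ∈ e.baseSet := mem_baseSet_trivializationAt _ _ _
  have hO : e.baseSet ∩ U ∈ nhds x₀ := (e.open_baseSet.inter hU).mem_nhds ⟨he, hx₀⟩
  have hO' : e.baseSet ∩ U' ∈ nhds x₀ := (e.open_baseSet.inter hU').mem_nhds ⟨he, hx₀'⟩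
  -- the frames in coordinates
  let L : M → SigSpace r s →L[ℝ] EuclideanSpace ℝ (Fin (r + s)) := fun x =>
    LinearMap.toContinuousLinearMap ((e.linearMapAt ℝ x).comp (f x).toLinearMap)
  have hLx : ∀ x ∈ e.baseSet, ∀ w, L x w = (e ⟨x, f x w⟩).2 := fun x hx w => by
    simp [L, e.coe_linearMapAt_of_mem hx]
  have hL : ContMDiffAt (𝓡 (r + s)) 𝓘(ℝ, SigSpace r s →L[ℝ] EuclideanSpace ℝ (Fin (r + s))) ∞ L x₀ := by
    refine (contMDiffOn_clm_of_apply (𝕜 := ℝ) (U := e.baseSet ∩ U) fun w => ?_).contMDiffAt hO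
    have h1 := ((hf w).mono (Set.inter_subset_right (s := e.baseSet)))
    have h2 := (e.contMDiffOn_section_iff (e.open_baseSet.inter hU) Set.inter_subset_left).1 h1
    exact h2.congr fun x hx => hLx x hx.1 w
  let K : ∀ x ∈ e.baseSet, SigSpace r s ≃L[ℝ] EuclideanSpace ℝ (Fin (r + s)) := fun x hx =>
    ((f x).trans (e.linearEquivAt ℝ x hx)).toContinuousLinearEquiv
  have hK : ∀ x (hx : x ∈ e.baseSet), (K x hx : SigSpace r s →L[ℝ] _) = L x := fun x hx => by
    ext1 w
    rw [hLx x hx]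
    rfl
  have hinv : ContMDiffAt (𝓡 (r + s)) 𝓘(ℝ, EuclideanSpace ℝ (Fin (r + s)) →L[ℝ] SigSpace r s) ∞
      (fun x => ContinuousLinearMap.inverse (L x)) x₀ := by
    have h1 := contDiffAt_map_inverse (𝕜 := ℝ) (n := ∞) (K x₀ he)
    rw [hK x₀ he] at h1
    exact h1.contMDiffAt.comp x₀ hL
  have hv : ContMDiffAt (𝓡 (r + s)) 𝓘(ℝ, EuclideanSpace ℝ (Fin (r + s))) ∞
      (fun x => (e ⟨x, f' x v⟩).2) x₀ := by
    have h1 := ((hf' v).mono (Set.inter_subset_right (s := e.baseSet)))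
    exact ((e.contMDiffOn_section_iff (e.open_baseSet.inter hU') Set.inter_subset_left).1
      h1).contMDiffAt hO'
  refine (hinv.clm_apply hv).congr_of_eventuallyEq ?_
  filter_upwards [e.open_baseSet.mem_nhds he] with x hx
  rw [← hK x hx, ContinuousLinearMap.inverse_equiv]
  apply (f x).injective
  apply (e.linearEquivAt ℝ x hx).injective
  rw [LinearEquiv.apply_symm_apply]
  exact ((K x hx).apply_symm_apply _).symm

theorem exists_smooth_frame (x₀ : M) : ∃ U : TopologicalSpace.Opens M, x₀ ∈ U ∧
    ∃ f : ∀ x : M, SigSpace r s ≃ₗ[ℝ] TSpace r s x,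
      ∀ v, SmoothFieldOn (fun x => f x v) (U : Set M) := by
  classical
  let e := trivializationAt (EuclideanSpace ℝ (Fin (r + s)))
    (TangentSpace (𝓡 (r + s)) : M → Type) x₀
  let κ : SigSpace r s ≃ₗ[ℝ] EuclideanSpace ℝ (Fin (r + s)) :=
    LinearEquiv.ofFinrankEq _ _ (by simp)
  refine ⟨⟨e.baseSet, e.open_baseSet⟩, mem_baseSet_trivializationAt _ _ _,
    fun x => if hx : x ∈ e.baseSet then κ.trans (e.linearEquivAt ℝ x hx).symm else κ, fun v => ?_⟩
  refine e.contMDiffOn_section_baseSet_iff.2 ((contMDiffOn_const (c := κ v)).congr fun x hx => ?_)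
  have h : (if hx : x ∈ e.baseSet then κ.trans (e.linearEquivAt ℝ x hx).symm else κ :
      SigSpace r s ≃ₗ[ℝ] TSpace r s x) = κ.trans (e.linearEquivAt ℝ x hx).symm := dif_pos hx
  refine (congrArg (fun F : SigSpace r s ≃ₗ[ℝ] TSpace r s x => (e ⟨x, F v⟩).2) h).trans ?_
  exact (e.linearEquivAt ℝ x hx).apply_symm_apply (κ v)

theorem existsUnique_glAut {x : M} (f f' : SigSpace r s ≃ₗ[ℝ] TSpace r s x) :
    ∃! A : GL (Fin r ⊕ Fin s) ℝ, (glAut A).trans f = f' := by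
  refine ⟨⟨LinearMap.toMatrix' (f'.trans f.symm).toLinearMap,
    LinearMap.toMatrix' (f.trans f'.symm).toLinearMap, ?_, ?_⟩, ?_, ?_⟩
  · rw [← LinearMap.toMatrix'_comp, ← LinearMap.toMatrix'_id]
    exact congrArg _ (LinearMap.ext fun v => by simp)
  · rw [← LinearMap.toMatrix'_comp, ← LinearMap.toMatrix'_id]
    exact congrArg _ (LinearMap.ext fun v => by simp)
  · apply LinearEquiv.toLinearMap_injective
    exact LinearMap.ext fun v => by simp [glAut_apply]
  · rintro A rfl
    ext1
    apply Matrix.toLin'.injective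
    exact LinearMap.ext fun v => by simp [glAut_apply]

theorem linSmoothOn_matrix {n : ℕ} {M : Type*} [TopologicalSpace M]
    [ChartedSpace (EuclideanSpace ℝ (Fin n)) M] {ι : Type*} [Fintype ι] [DecidableEq ι]
    {A : M → Matrix ι ι ℝ} {U : Set M}
    (hA : ∀ i j, ContMDiffOn (𝓡 n) 𝓘(ℝ) ∞ (fun x => A x i j) U) : LinSmoothOn n A U := by
  intro ℓ
  have h : (fun x => ℓ (A x)) = fun x => ∑ i, ∑ j, A x i j * ℓ (Matrix.single i j 1) := by
    funext x
    conv_lhs => rw [Matrix.matrix_eq_sum_single (A x)]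
    simp only [map_sum]
    refine Finset.sum_congr rfl fun i _ => Finset.sum_congr rfl fun j _ => ?_
    rw [← smul_eq_mul, ← map_smul, Matrix.smul_single, smul_eq_mul, mul_one]
  rw [h]
  exact contMDiffOn_finsetSum fun i _ => contMDiffOn_finsetSum fun j _ =>
    (hA i j).mul contMDiffOn_const

/-- `L(M)`: the principal `GL(D, ℝ)`-bundle of linear frames `ℝ^D ≃ T_x M`. -/
def linearFrameBundle (r s : ℕ) (M : Type u) [TopologicalSpace M]
    [ChartedSpace (EuclideanSpace ℝ (Fin (r + s))) M] [IsManifold (𝓡 (r + s)) ∞ M] :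
    PrincipalBundle.{u, 0} (r + s) M (GL (Fin r ⊕ Fin s) ℝ) where
  Fiber x := SigSpace r s ≃ₗ[ℝ] TSpace r s x
  act f A := (glAut A).trans f
  act_one f := by
    apply LinearEquiv.toLinearMap_injective
    exact LinearMap.ext fun v => by simp
  act_mul f A B := by
    apply LinearEquiv.toLinearMap_injective
    exact LinearMap.ext fun v => by simp
  existsUnique_act f f' := existsUnique_glAut f f'
  atlas := {σ | ∀ v, SmoothFieldOn (fun x => σ.2 x v) (σ.1 : Set M)}
  cover x := by
    obtain ⟨U, hU, f, hf⟩ := exists_smooth_frame (r := r) (s := s) x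
    exact ⟨(U, f), hf, hU⟩
  smooth_transition := by
    rintro ⟨U, f⟩ hf ⟨U', f'⟩ hf'
    choose A hA using fun x : M => (existsUnique_glAut (f x) (f' x)).exists
    refine ⟨A, fun x _ => hA x, linSmoothOn_matrix fun i j => ?_⟩
    have h := frame_transition_smooth U.isOpen U'.isOpen hf hf' (Pi.single j 1)
    refine ((ContinuousLinearMap.proj (R := ℝ) (φ := fun _ : Fin r ⊕ Fin s => ℝ)
      i).contMDiff.comp_contMDiffOn h).congr fun x _ => ?_
    have h1 : (f x).symm (f' x (Pi.single j 1)) = (A x).val *ᵥ Pi.single j 1 := by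
      rw [← hA x, LinearEquiv.trans_apply, LinearEquiv.symm_apply_apply, glAut_apply]
    change (A x).val i j = (f x).symm (f' x (Pi.single j 1)) i
    rw [h1]
    simp

end Geometry

/-! ### The representations on spinors and on tensors `γ` -/

section Model

variable {n : ℕ} {M : Type*} [TopologicalSpace M] [ChartedSpace (EuclideanSpace ℝ (Fin n)) M]

/-- The space of spinors `ℂ^d`. -/
def Spinor (d : ℕ) : Type := Fin d → ℂ

instance (d : ℕ) : NormedAddCommGroup (Spinor d) := inferInstanceAs (NormedAddCommGroup (Fin d → ℂ))

instance (d : ℕ) : NormedSpace ℂ (Spinor d) := inferInstanceAs (NormedSpace ℂ (Fin d → ℂ))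

instance (d : ℕ) : FiniteDimensional ℂ (Spinor d) :=
  inferInstanceAs (FiniteDimensional ℂ (Fin d → ℂ))

/-- A matrix as an operator on `ℂ^d`. -/
def matOp (d : ℕ) : Matrix (Fin d) (Fin d) ℂ →ₐ[ℂ] (Spinor d →L[ℂ] Spinor d) :=
  AlgHom.ofLinearMap
    { toFun := fun A => LinearMap.toContinuousLinearMap (E := Spinor d) (F' := Spinor d)
        (Matrix.toLin' A)
      map_add' := fun A B => ContinuousLinearMap.ext fun v => Matrix.add_mulVec A B v
      map_smul' := fun c A => ContinuousLinearMap.ext fun v => Matrix.smul_mulVec c A v }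
    (ContinuousLinearMap.ext fun v => Matrix.one_mulVec v)
    fun A B => ContinuousLinearMap.ext fun v => (Matrix.mulVec_mulVec v A B).symm

theorem matOp_apply {d : ℕ} (A : Matrix (Fin d) (Fin d) ℂ) (v : Fin d → ℂ) :
    matOp d A v = A *ᵥ v := rfl

theorem LinSmoothOn.comp {A B : Type*} [AddCommGroup A] [Module ℝ A] [AddCommGroup B] [Module ℝ B]
    {f : M → A} {U : Set M} (hf : LinSmoothOn n f U) (T : A →ₗ[ℝ] B) :
    LinSmoothOn n (fun x => T (f x)) U := fun ℓ => hf (ℓ.comp T)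

theorem LinSmoothOn.contMDiffOn {A B : Type*} [AddCommGroup A] [Module ℝ A] [NormedAddCommGroup B]
    [NormedSpace ℝ B] [FiniteDimensional ℝ B] {f : M → A} {U : Set M} (hf : LinSmoothOn n f U)
    (T : A →ₗ[ℝ] B) : ContMDiffOn (𝓡 n) 𝓘(ℝ, B) ∞ (fun x => T (f x)) U := by
  let b := Module.finBasis ℝ B
  have h : (fun x => T (f x)) = fun x => ∑ i, (b.coord i) (T (f x)) • b i := by
    funext x
    exact (b.sum_repr (T (f x))).symm
  rw [h]
  exact contMDiffOn_finsetSum fun i _ => (hf ((b.coord i).comp T)).smul contMDiffOn_const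

instance (d : ℕ) : FiniteDimensional ℝ (Spinor d →L[ℂ] Spinor d) :=
  Module.Finite.trans (R := ℝ) ℂ _

theorem matOp_smooth {d : ℕ} {h : M → Matrix (Fin d) (Fin d) ℂ} {U : Set M}
    (hh : LinSmoothOn n h U) :
    ContMDiffOn (𝓡 n) 𝓘(ℝ, Spinor d →L[ℂ] Spinor d) ∞ (fun x => matOp d (h x)) U :=
  hh.contMDiffOn ((matOp d).toLinearMap.restrictScalars ℝ)

theorem ringInverse_map {R S : Type*} [Ring R] [MonoidWithZero S] (φ : R →* S) (u : Rˣ) :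
    Ring.inverse (φ u.val) = φ (u⁻¹).val := by
  have h := Ring.inverse_unit (Units.map φ u)
  rw [← map_inv] at h
  exact h

theorem ringInverse_smooth {R : Type*} [NormedRing R] [NormedAlgebra ℝ R] [HasSummableGeomSeries R]
    {f : M → R} {U : Set M} (hf : ContMDiffOn (𝓡 n) 𝓘(ℝ, R) ∞ f U) (hu : ∀ x, IsUnit (f x)) :
    ContMDiffOn (𝓡 n) 𝓘(ℝ, R) ∞ (fun x => Ring.inverse (f x)) U := by
  intro x hx
  have h := contDiffAt_ringInverse ℝ (n := ∞) (hu x).unit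
  exact ContMDiffAt.comp_contMDiffWithinAt x
    (by simpa using h.contMDiffAt) (hf x hx)

/-- The standard representation of `GL(d, ℂ)`. -/
def glRep (n : ℕ) (M : Type*) [TopologicalSpace M] [ChartedSpace (EuclideanSpace ℝ (Fin n)) M]
    (d : ℕ) : SmoothRep n M (GL (Fin d) ℂ) (Spinor d) where
  rep := (matOp d : Matrix (Fin d) (Fin d) ℂ →* _).comp (Units.coeHom _)
  smooth _ _ hh := matOp_smooth hh

/-- The pullback of a representation along a smooth homomorphism. -/
def SmoothRep.comap {G H F : Type*} [Group G] [SmoothTarget n M G] [Group H] [SmoothTarget n M H]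
    [NormedAddCommGroup F] [NormedSpace ℂ F] (ρ : SmoothRep n M H F) (φ : G →* H)
    (hφ : ∀ (h : M → G) (U : Set M), SmoothTarget.SmoothOn n h U →
      SmoothTarget.SmoothOn n (fun x => φ (h x)) U) : SmoothRep n M G F where
  rep := ρ.rep.comp φ
  smooth h U hh := ρ.smooth _ U (hφ h U hh)

variable {r s : ℕ} (Γ : DiracMatrices r s)

theorem spinRep_smooth (h : M → Spin r s) (U : Set M) (hh : SmoothTarget.SmoothOn n h U) :
    SmoothTarget.SmoothOn n (fun x => Γ.spinRep (h x)) U :=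
  LinSmoothOn.comp (f := fun x => ((h x : (Cl r s)ˣ) : Cl r s)) hh Γ.cliffordRep.toLinearMap

theorem spinCRep_smooth (h : M → SpinC r s) (U : Set M) (hh : SmoothTarget.SmoothOn n h U) :
    SmoothTarget.SmoothOn n (fun x => Γ.spinCRep (h x)) U := by
  intro ℓ x hx
  obtain ⟨W, hW, hxW, a, b, ha, hb, hab⟩ := hh x hx
  have ha' := spinRep_smooth Γ a _ ha
  have hb' : LinSmoothOn n (fun x => (b x : ℂ)) (U ∩ W) := hb
  have key : ContMDiffOn (𝓡 n) 𝓘(ℝ) ∞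
      (fun y => ℓ ((b y : ℂ) • (Γ.spinRep (a y)).val)) (U ∩ W) := by
    let I' : Matrix (Fin (dGamma r s)) (Fin (dGamma r s)) ℂ →ₗ[ℝ]
        Matrix (Fin (dGamma r s)) (Fin (dGamma r s)) ℂ :=
      (LinearMap.lsmul ℂ _ Complex.I).restrictScalars ℝ
    refine (((hb' Complex.reLm).mul (ha' ℓ)).add
      ((hb' Complex.imLm).mul (ha' (ℓ.comp I')))).congr fun y _ => ?_
    have h1 : (b y : ℂ) • (Γ.spinRep (a y)).val = (b y : ℂ).re • (Γ.spinRep (a y)).val +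
        (b y : ℂ).im • I' (Γ.spinRep (a y)).val := by
      conv_lhs => rw [← Complex.re_add_im (b y : ℂ)]
      simp only [I', LinearMap.coe_restrictScalars, LinearMap.lsmul_apply, add_smul, mul_smul,
        Complex.coe_smul]
    rw [h1, map_add, map_smul, map_smul]
    rfl
  have hval : ∀ y ∈ U ∩ W, ℓ (Γ.spinCRep (h y)).val = ℓ ((b y : ℂ) • (Γ.spinRep (a y)).val) := by
    intro y hy
    rw [hab y hy]
    exact congrArg ℓ (Algebra.smul_def _ _).symm
  exact ((key.congr hval) x ⟨hx, hxW⟩).mono_of_mem_nhdsWithin (Filter.inter_mem self_mem_nhdsWithin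
      (mem_nhdsWithin_of_mem_nhds (hW.mem_nhds hxW)))

/-- The representation of `Spin(r, s)` on `ℂ^{d_γ}`. -/
def spinSmoothRep (n : ℕ) (M : Type*) [TopologicalSpace M]
    [ChartedSpace (EuclideanSpace ℝ (Fin n)) M] : SmoothRep n M (Spin r s) (Spinor (dGamma r s)) :=
  (glRep n M _).comap Γ.spinRep (spinRep_smooth Γ)

/-- The representation of `Spin^ℂ(r, s)` on `ℂ^{d_γ}`. -/
def spinCSmoothRep (n : ℕ) (M : Type*) [TopologicalSpace M]
    [ChartedSpace (EuclideanSpace ℝ (Fin n)) M] : SmoothRep n M (SpinC r s) (Spinor (dGamma r s)) :=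
  (glRep n M _).comap Γ.spinCRep (spinCRep_smooth Γ)

/-- `(ℝ^D)* ⊗ End(ℂ^d)`, i.e. the linear maps `ℝ^D → End(ℂ^d)`. -/
def GammaModel (r s d : ℕ) : Type := SigSpace r s →L[ℝ] (Spinor d →L[ℂ] Spinor d)

instance (r s d : ℕ) : NormedAddCommGroup (GammaModel r s d) :=
  inferInstanceAs (NormedAddCommGroup (SigSpace r s →L[ℝ] (Spinor d →L[ℂ] Spinor d)))

instance (r s d : ℕ) : NormedSpace ℂ (GammaModel r s d) :=
  inferInstanceAs (NormedSpace ℂ (SigSpace r s →L[ℝ] (Spinor d →L[ℂ] Spinor d)))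

instance (r s d : ℕ) : FiniteDimensional ℂ (GammaModel r s d) := by
  have : FiniteDimensional ℝ (SigSpace r s →L[ℝ] (Spinor d →L[ℂ] Spinor d)) := inferInstance
  have h : FiniteDimensional ℝ (GammaModel r s d) := this
  exact Module.Finite.of_restrictScalars_finite ℝ ℂ _

/-- `T` as a linear map `ℝ^D → End(ℂ^d)`. -/
def GammaModel.op {r s d : ℕ} (T : GammaModel r s d) :
    SigSpace r s →L[ℝ] (Spinor d →L[ℂ] Spinor d) := T

/-- The operator `T ↦ S ∘ T(a ·) ∘ S'` on `(ℝ^D)* ⊗ End(ℂ^d)`. -/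
def gammaOp {r s d : ℕ} (a : SigSpace r s →L[ℝ] SigSpace r s) (S S' : Spinor d →L[ℂ] Spinor d) :
    GammaModel r s d →L[ℂ] GammaModel r s d :=
  LinearMap.toContinuousLinearMap
    { toFun := fun T => (conjL S' S).comp (T.op.comp a)
      map_add' := fun T T' => by
        refine ContinuousLinearMap.ext fun v => ContinuousLinearMap.ext fun w => ?_
        exact map_add S _ _
      map_smul' := fun c T => by
        refine ContinuousLinearMap.ext fun v => ContinuousLinearMap.ext fun w => ?_
        exact map_smul S c _ }

theorem gammaOp_apply {r s d : ℕ} (a : SigSpace r s →L[ℝ] SigSpace r s)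
    (S S' : Spinor d →L[ℂ] Spinor d) (T : GammaModel r s d) (v : SigSpace r s)
    (w : Spinor d) : (gammaOp a S S' T).op v w = S (T.op (a v) (S' w)) :=
  rfl

/-- A real matrix as an operator on `ℝ^D`. -/
def realOp (r s : ℕ) : Matrix (Fin r ⊕ Fin s) (Fin r ⊕ Fin s) ℝ →ₐ[ℝ]
    (SigSpace r s →L[ℝ] SigSpace r s) :=
  AlgHom.ofLinearMap
    { toFun := fun A => LinearMap.toContinuousLinearMap (Matrix.toLin' A)
      map_add' := fun A B => ContinuousLinearMap.ext fun v => Matrix.add_mulVec A B v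
      map_smul' := fun c A => ContinuousLinearMap.ext fun v => Matrix.smul_mulVec c A v }
    (ContinuousLinearMap.ext fun v => Matrix.one_mulVec v)
    fun A B => ContinuousLinearMap.ext fun v => (Matrix.mulVec_mulVec v A B).symm

/-- The representation of `GL(D, ℝ) × GL(d, ℂ)` on `(ℝ^D)* ⊗ End(ℂ^d)`: the factor `GL(D, ℝ)` acts
on the index of `(ℝ^D)*` and the factor `GL(d, ℂ)` acts on `End(ℂ^d)` by conjugation,
`(A, S) · T = S ∘ T(A⁻¹ ·) ∘ S⁻¹`. -/
def gammaRep (n : ℕ) (M : Type*) [TopologicalSpace M] [ChartedSpace (EuclideanSpace ℝ (Fin n)) M]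
    (r s d : ℕ) : SmoothRep n M (GL (Fin r ⊕ Fin s) ℝ × GL (Fin d) ℂ) (GammaModel r s d) where
  rep :=
    { toFun := fun p => gammaOp (realOp r s (p.1⁻¹).val) (matOp d p.2.val) (matOp d (p.2⁻¹).val)
      map_one' := by
        refine ContinuousLinearMap.ext fun T => ContinuousLinearMap.ext fun v =>
          ContinuousLinearMap.ext fun w => (gammaOp_apply _ _ _ T v w).trans ?_
        simp
        rfl
      map_mul' := fun p q => by
        refine ContinuousLinearMap.ext fun T => ContinuousLinearMap.ext fun v =>
          ContinuousLinearMap.ext fun w => (gammaOp_apply _ _ _ T v w).trans ?_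
        simp only [Prod.fst_mul, Prod.snd_mul, mul_inv_rev, Units.val_mul, map_mul]
        rfl }
  smooth h U hh := by
    refine contMDiffOn_clm_of_apply fun T => ?_
    have h1 := hh.1
    have h2 := hh.2
    have hS := matOp_smooth h2
    have hA : ContMDiffOn (𝓡 n) 𝓘(ℝ, SigSpace r s →L[ℝ] SigSpace r s) ∞
        (fun x => realOp r s (h x).1.val) U := LinSmoothOn.contMDiffOn h1 (realOp r s).toLinearMap
    have hS' := ringInverse_smooth hS fun x => (h x).2.isUnit.map (matOp d)
    have hA' := ringInverse_smooth hA fun x => (h x).1.isUnit.map (realOp r s)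
    have eS : ∀ x, Ring.inverse (matOp d (h x).2.val) = matOp d ((h x).2⁻¹).val := fun x =>
      ringInverse_map (matOp d : Matrix (Fin d) (Fin d) ℂ →* (Spinor d →L[ℂ] Spinor d)) (h x).2
    have eA : ∀ x, Ring.inverse (realOp r s (h x).1.val) = realOp r s ((h x).1⁻¹).val := fun x =>
      ringInverse_map (realOp r s : Matrix (Fin r ⊕ Fin s) (Fin r ⊕ Fin s) ℝ →*
        (SigSpace r s →L[ℝ] SigSpace r s)) (h x).1
    simp only [eS] at hS'
    simp only [eA] at hA'
    have key : ContMDiffOn (𝓡 n) 𝓘(ℝ, SigSpace r s →L[ℝ] (Spinor d →L[ℂ] Spinor d)) ∞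
        (fun x => (conjL (matOp d ((h x).2⁻¹).val) (matOp d (h x).2.val)).comp
          (T.op.comp (realOp r s ((h x).1⁻¹).val))) U :=
      (conjL_smooth hS' hS).clm_comp (contMDiffOn_const.clm_comp hA')
    exact key

end Model

/-! ### Spinor bundles, their extension, and Dirac structures -/

section Extension

open Bundle

universe u w

variable {r s : ℕ} {M : Type u} [TopologicalSpace M]
  [ChartedSpace (EuclideanSpace ℝ (Fin (r + s))) M] [IsManifold (𝓡 (r + s)) ∞ M]

/-- A family of fibrewise real linear isomorphisms `E_x ≃ E'_x` which is a diffeomorphism of the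
total spaces (covering the identity of `M`). -/
def IsSmoothIso {n : ℕ} {M : Type*} [TopologicalSpace M] [ChartedSpace (EuclideanSpace ℝ (Fin n)) M]
    {F F' : Type*} [NormedAddCommGroup F] [NormedSpace ℝ F]
    [NormedAddCommGroup F'] [NormedSpace ℝ F'] {E E' : M → Type*}
    [TopologicalSpace (TotalSpace F E)] [∀ x, TopologicalSpace (E x)] [FiberBundle F E]
    [TopologicalSpace (TotalSpace F' E')] [∀ x, TopologicalSpace (E' x)] [FiberBundle F' E']
    (θ : ∀ x, E x ≃ E' x) : Prop :=
  ContMDiff ((𝓡 n).prod 𝓘(ℝ, F)) ((𝓡 n).prod 𝓘(ℝ, F')) ∞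
      (fun z : TotalSpace F E => (⟨z.1, θ z.1 z.2⟩ : TotalSpace F' E')) ∧
    ContMDiff ((𝓡 n).prod 𝓘(ℝ, F')) ((𝓡 n).prod 𝓘(ℝ, F)) ∞
      (fun z : TotalSpace F' E' => (⟨z.1, (θ z.1).symm z.2⟩ : TotalSpace F E))

/-- The fibre over `x` of `T*M ⊗ End(E)`: the real linear maps `T_x M → End_ℂ(E_x)`. -/
abbrev GammaFiber (r s : ℕ) {M : Type u} [TopologicalSpace M]
    [ChartedSpace (EuclideanSpace ℝ (Fin (r + s))) M] (E : M → Type*) [∀ x, AddCommGroup (E x)]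
    [∀ x, Module ℂ (E x)] [∀ x, TopologicalSpace (E x)] [∀ x, IsTopologicalAddGroup (E x)]
    [∀ x, ContinuousSMul ℂ (E x)] (x : M) : Type _ :=
  TSpace r s x →L[ℝ] (E x →L[ℂ] E x)

/-- The model fibre of `T*M ⊗ End(E)` for `E` of rank `d`. -/
abbrev GammaTarget (r s d : ℕ) : Type :=
  EuclideanSpace ℝ (Fin (r + s)) →L[ℝ] (Spinor d →L[ℂ] Spinor d)

variable {d : ℕ} {E : M → Type*} [∀ x, AddCommGroup (E x)] [∀ x, Module ℂ (E x)]
  [∀ x, TopologicalSpace (E x)] [∀ x, IsTopologicalAddGroup (E x)] [∀ x, ContinuousSMul ℂ (E x)]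
  [TopologicalSpace (TotalSpace (Spinor d) E)] [FiberBundle (Spinor d) E]
  [VectorBundle ℂ (Spinor d) E]

set_option synthInstance.maxHeartbeats 400000 in
instance gammaTopology : TopologicalSpace (TotalSpace (GammaTarget r s d) (GammaFiber r s E)) :=
  inferInstance

set_option synthInstance.maxHeartbeats 400000 in
instance gammaFiberBundle : FiberBundle (GammaTarget r s d) (GammaFiber r s E) := inferInstance

/-- `γ` is a Dirac structure on `(M, g)`: a smooth section of `T*M ⊗ End(E)`, `E` of rank `d`, with
`{γ(X), γ(Y)} = -2 g(X, Y) 𝟙`. -/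
structure IsDiracStructure (d : ℕ) (g : PseudoRiemannianMetric r s M) {E : M → Type*}
    [∀ x, AddCommGroup (E x)] [∀ x, Module ℂ (E x)] [∀ x, TopologicalSpace (E x)]
    [∀ x, IsTopologicalAddGroup (E x)] [∀ x, ContinuousSMul ℂ (E x)]
    [TopologicalSpace (TotalSpace (Spinor d) E)] [FiberBundle (Spinor d) E]
    [VectorBundle ℂ (Spinor d) E] (γ : ∀ x : M, GammaFiber r s E x) : Prop where
  smooth : ContMDiff (𝓡 (r + s)) ((𝓡 (r + s)).prod 𝓘(ℝ, GammaTarget r s d)) ∞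
    (fun x => (⟨x, γ x⟩ : TotalSpace (GammaTarget r s d) (GammaFiber r s E)))
  clifford : ∀ (x : M) (X Y : TSpace r s x) (e : E x),
    γ x X (γ x Y e) + γ x Y (γ x X e) = ((-2 * g.val x X Y : ℝ) : ℂ) • e

variable {G : Type*} [Group G] [SmoothTarget (r + s) M G]
  {g : PseudoRiemannianMetric r s M} {o : ManifoldOrientation r s M}

/-- `γ` is the Dirac structure on `P ×_ρ ℂ^{d_γ}` determined by the constant Dirac matrices `Γ`: in
the frames of `T_x M` and of `E_x` given by one and the same `p`, it is given by the matrices `Γ`. -/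
def IsDiracStructureOf (Γ : DiracMatrices r s) (P : PrincipalBundle.{u, w} (r + s) M G)
    (Φ : ∀ x, P.Fiber x → SOFrame g o x) (ρ : SmoothRep (r + s) M G (Spinor (dGamma r s)))
    (γ : ∀ x : M, GammaFiber r s (Assoc P ρ) x) : Prop :=
  IsDiracStructure (dGamma r s) g γ ∧
    ∀ (x : M) (p : P.Fiber x) (v : SigSpace r s) (ψ : Spinor (dGamma r s)),
      γ x ((Φ x p).frame v) (Assoc.mk P ρ p ψ) = Assoc.mk P ρ p (matOp _ (Γ.lin v) ψ)

/-- The extension of the structure group of the spinor bundle `E = P ×_φ ℂ^{d_γ}` from `G` to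
`GL(d_γ, ℂ)` along `φ`, for a principal `G`-bundle `P` with a map `Φ` to `SO(M)`. -/
def ExtendsToGL (Γ : DiracMatrices r s) (P : PrincipalBundle.{u, w} (r + s) M G)
    (Φ : ∀ x, P.Fiber x → SOFrame g o x) (φ : G →* GL (Fin (dGamma r s)) ℂ)
    (hφ : ∀ (h : M → G) (U : Set M), SmoothTarget.SmoothOn (r + s) h U →
      SmoothTarget.SmoothOn (r + s) (fun x => φ (h x)) U) : Prop :=
  let d := dGamma r s
  let ρ : SmoothRep (r + s) M G (Spinor d) := (glRep (r + s) M d).comap φ hφ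
  -- `G` is a subgroup of `GL(d_γ, ℂ)`
  Function.Injective φ ∧
  -- the Dirac structure `γ` on `E`
  ∃ γ : ∀ x : M, GammaFiber r s (Assoc P ρ) x, IsDiracStructureOf Γ P Φ ρ γ ∧
  -- a principal `GL(d_γ, ℂ)`-bundle `P^G` which contains `P` as a smooth reduction
  ∃ (PG : PrincipalBundle.{u, w} (r + s) M (GL (Fin d) ℂ)) (ι : ∀ x, P.Fiber x → PG.Fiber x),
    (∀ x, Function.Injective (ι x)) ∧
    (∀ x (p : P.Fiber x) (h : G), ι x (P.act p h) = PG.act (ι x p) (φ h)) ∧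
    (∀ σ ∈ P.atlas, PG.IsSmoothSectionOn (σ.1 : Set M) (fun x => ι x (σ.2 x))) ∧
  -- `E^G = P^G ×_{GL(d_γ, ℂ)} ℂ^{d_γ}` is the same manifold, and the same vector bundle, as `E`
  ∃ θ : ∀ x, Assoc P ρ x ≃ₗ[ℂ] Assoc PG (glRep (r + s) M d) x,
    IsSmoothIso (n := r + s) (F := Spinor d) (F' := Spinor d) (fun x => (θ x).toEquiv) ∧
    (∀ x (p : P.Fiber x) (ψ : Spinor d), θ x (Assoc.mk P ρ p ψ) = Assoc.mk PG _ (ι x p) ψ) ∧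
  -- `T*M ⊗ End(E^G)` is associated to `L(M) ×_M P^G`, with structure group `GL(D, ℝ) × GL(d_γ, ℂ)`
  (∃ Θ : ∀ x, Assoc ((linearFrameBundle r s M).fiberProd PG) (gammaRep (r + s) M r s d) x ≃ₗ[ℝ]
      GammaFiber r s (Assoc PG (glRep (r + s) M d)) x,
    IsSmoothIso (n := r + s) (F := GammaModel r s d) (F' := GammaTarget r s d) (fun x => (Θ x).toEquiv) ∧
    ∀ x (f : SigSpace r s ≃ₗ[ℝ] TSpace r s x) (q : PG.Fiber x) (T : GammaModel r s d)
      (v : SigSpace r s) (ψ : Spinor d),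
      Θ x (Assoc.mk _ _ (f, q) T) (f v) (Assoc.mk PG _ q ψ) = Assoc.mk PG _ q (T.op v ψ)) ∧
  -- `γ` extends to a section of `T*M ⊗ End(E^G)`
  ∃! γG : ∀ x : M, GammaFiber r s (Assoc PG (glRep (r + s) M d)) x,
    IsDiracStructure d g γG ∧
    ∀ (x : M) (X : TSpace r s x) (e : Assoc P ρ x), γG x X (θ x e) = θ x (γ x X e)

end Extension
end SpinBase

end

universe u w w'

/-!
`Spin` and `Spin^ℂ` are treated at once. All that matters about the representation `φ` of `G` is that
it is faithful and that the Dirac matrices intertwine it with the homomorphism `c : G → SO(r, s)`,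
`φ(h) γ(v) = γ(c(h) v) φ(h)`; see `extendsToGL_of_intertwining`.

*Faithfulness.* If `φ(h)` is a scalar matrix, it commutes with all `γ(v)`, and since `v ↦ γ(v)` is
injective (`DiracMatrices.lin_injective`), `h` is in the kernel of the covering
`Spin(r, s) → SO(r, s)`. That kernel is `{±1}` (`Spin.eq_one_or_eq_neg_one`): an even element `h` of
the Clifford algebra which commutes with all vectors has vanishing contractions, because twisted
commutators with vectors are contractions, hence it is a scalar (`eq_algebraMap_of_commute`), and the
scalar is `±1` because reversion takes `h` to `±h⁻¹`. So neither `φ` nor its extension to `Spin^ℂ` has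
a kernel, in even and in odd dimensions.

*The extended bundle.* For `P^G` take the bundle of all complex frames `ℂ^d ≃ E_x` of the spinor
bundle `E = P ×_φ ℂ^d` (`spinorFrameBundle`), with the local sections of `P` as an atlas; a point `p`
of `P` becomes the frame `ψ ↦ [p, ψ]`, which determines `p` because `φ` is faithful. The
isomorphism `[p, ψ] ↦ [ι(p), ψ]` is the identity in the local trivializations given by a local
section of `P`.

*Smoothness.* A fibrewise linear map is smooth as soon as it maps a smooth local frame to smooth
sections (`contMDiff_of_contMDiffOn_symm`), and a smooth fibrewise isomorphism has a smooth inverse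
(`contMDiff_symm_of_linearEquiv`). A section of `T*M ⊗ End(E)` with constant components in a smooth
frame of `TM` and a local trivialization of `E` is smooth (`contMDiffOn_gammaFiber`). This gives the
description of `T*M ⊗ End(E^G)` as an associated bundle (`isSmoothIso_gammaBundleEquiv`), and, with
the constant Dirac matrices as components, the Dirac structures on `E` and on `E^G`
(`exists_diracStructure`): by the intertwining property they do not depend on the frame.
-/

noncomputable section

namespace SpinBase

/-! ### Contractions and the kernel of the spin covering -/

section Clifford

open CliffordAlgebra

/-- On `⋀^k`, the number operator `∑ₐ eₐ ∧ (eᵃ ⌋ ·)` is multiplication by `k`. -/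
theorem sum_ι_mul_contractLeft {I : Type*} [Fintype I] [DecidableEq I] {k : ℕ}
    {x : ExteriorAlgebra ℝ (I → ℝ)} (hx : x ∈ ⋀[ℝ]^k (I → ℝ)) :
    ∑ a, ExteriorAlgebra.ι ℝ (Pi.single a 1 : I → ℝ) *
      (contractLeft (Q := (0 : QuadraticForm ℝ (I → ℝ))) (LinearMap.proj a) x) = (k : ℝ) • x := by
  induction hx using Submodule.pow_induction_on_left' with
  | algebraMap c =>
    simp only [Nat.cast_zero, zero_smul]
    refine Finset.sum_eq_zero fun a _ => ?_
    exact (congrArg _ (contractLeft_algebraMap (Q := (0 : QuadraticForm ℝ (I → ℝ))) _ c)).trans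
      (mul_zero _)
  | add x y i _ _ hx hy => simp only [map_add, mul_add, Finset.sum_add_distrib, hx, hy, smul_add]
  | mem_mul m hm i x _ ih =>
    obtain ⟨v, rfl⟩ := hm
    have h : ∀ a : I, contractLeft (Q := (0 : QuadraticForm ℝ (I → ℝ))) (LinearMap.proj a)
        (ExteriorAlgebra.ι ℝ v * x) = v a • x - ExteriorAlgebra.ι ℝ v *
          contractLeft (Q := (0 : QuadraticForm ℝ (I → ℝ))) (LinearMap.proj a) x :=
      fun a => contractLeft_ι_mul (Q := (0 : QuadraticForm ℝ (I → ℝ))) _ v x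
    have hv : ∑ a, v a • ExteriorAlgebra.ι ℝ (Pi.single a 1 : I → ℝ) = ExteriorAlgebra.ι ℝ v := by
      simp only [← map_smul, ← map_sum]
      exact congrArg _ (pi_eq_sum_univ' v).symm
    have hswap : ∀ (w : I → ℝ) (y : ExteriorAlgebra ℝ (I → ℝ)), ExteriorAlgebra.ι ℝ w *
        (ExteriorAlgebra.ι ℝ v * y) = -(ExteriorAlgebra.ι ℝ v * (ExteriorAlgebra.ι ℝ w * y)) := by
      intro w y
      rw [← mul_assoc, ← mul_assoc, ← neg_mul,
        eq_neg_of_add_eq_zero_left (ExteriorAlgebra.ι_add_mul_swap w v)]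
    simp only [h, mul_sub, hswap, sub_neg_eq_add, Finset.sum_add_distrib, ← Finset.mul_sum, ih,
      mul_smul_comm, ← smul_mul_assoc, ← Finset.sum_mul, hv]
    push_cast
    rw [smul_mul_assoc, smul_mul_assoc, add_smul, one_smul, add_comm]

/-- An element of the exterior algebra all of whose contractions vanish is a scalar: it is in the
kernel of the number operator. -/
theorem exterior_eq_algebraMap_of_contractLeft {I : Type*} [Fintype I] [DecidableEq I]
    {x : ExteriorAlgebra ℝ (I → ℝ)}
    (hx : ∀ a, contractLeft (Q := (0 : QuadraticForm ℝ (I → ℝ))) (LinearMap.proj a) x = 0) :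
    ∃ c : ℝ, x = algebraMap ℝ _ c := by
  classical
  let 𝒜 : ℕ → Submodule ℝ (ExteriorAlgebra ℝ (I → ℝ)) := fun i => ⋀[ℝ]^i (I → ℝ)
  let N : ExteriorAlgebra ℝ (I → ℝ) →ₗ[ℝ] ExteriorAlgebra ℝ (I → ℝ) :=
    ∑ a, (LinearMap.mulLeft ℝ (ExteriorAlgebra.ι ℝ (Pi.single a 1 : I → ℝ))).comp
      (contractLeft (Q := (0 : QuadraticForm ℝ (I → ℝ))) (LinearMap.proj a))
  have hN : ∀ y, N y = ∑ a, ExteriorAlgebra.ι ℝ (Pi.single a 1 : I → ℝ) *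
      (contractLeft (Q := (0 : QuadraticForm ℝ (I → ℝ))) (LinearMap.proj a) y) := fun y => by
    simp only [N, LinearMap.sum_apply, LinearMap.comp_apply, LinearMap.mulLeft_apply]
  -- the number operator multiplies the component of degree `i` by `i`
  have key : ∀ y : ExteriorAlgebra ℝ (I → ℝ), ∀ i,
      (DirectSum.decompose 𝒜 (N y) i : ExteriorAlgebra ℝ (I → ℝ)) =
        (i : ℝ) • (DirectSum.decompose 𝒜 y i : ExteriorAlgebra ℝ (I → ℝ)) := by
    intro y i
    induction y using DirectSum.Decomposition.inductionOn 𝒜 with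
    | zero => simp
    | @homogeneous j m =>
      rw [hN, sum_ι_mul_contractLeft m.2]
      by_cases hij : i = j
      · subst hij
        rw [DirectSum.decompose_smul, DirectSum.smul_apply]
        rfl
      · rw [DirectSum.decompose_smul, DirectSum.smul_apply, Submodule.coe_smul,
          DirectSum.decompose_of_mem_ne 𝒜 m.2 (Ne.symm hij), smul_zero, smul_zero]
    | add y z hy hz =>
      simp only [map_add, DirectSum.decompose_add, DirectSum.add_apply, Submodule.coe_add, hy, hz,
        smul_add]
  have h0 : N x = 0 := by
    rw [hN]
    exact Finset.sum_eq_zero fun a _ => by rw [hx a, mul_zero]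
  have hi : ∀ i, i ≠ 0 → (DirectSum.decompose 𝒜 x i : ExteriorAlgebra ℝ (I → ℝ)) = 0 := by
    intro i hi
    have h := key x i
    rw [h0] at h
    simp only [DirectSum.decompose_zero, DirectSum.zero_apply, Submodule.coe_zero] at h
    exact (smul_eq_zero.1 h.symm).resolve_left (Nat.cast_ne_zero.2 hi)
  have hsum : x = (DirectSum.decompose 𝒜 x 0 : ExteriorAlgebra ℝ (I → ℝ)) := by
    conv_lhs => rw [← DirectSum.sum_support_decompose 𝒜 x]
    by_cases h : (0 : ℕ) ∈ (DirectSum.decompose 𝒜 x).support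
    · exact Finset.sum_eq_single_of_mem 0 h fun i _ => hi i
    · rw [Finset.sum_eq_zero, DFinsupp.notMem_support_iff.1 h]
      · rfl
      · intro i hi'
        exact hi i fun h' => h (h' ▸ hi')
  have hmem : x ∈ (⋀[ℝ]^0 (I → ℝ)) := hsum ▸ (DirectSum.decompose 𝒜 x 0).2
  rw [ExteriorAlgebra.exteriorPower, pow_zero, Submodule.mem_one] at hmem
  obtain ⟨c, hc⟩ := hmem
  exact ⟨c, hc.symm⟩

/-- The same in a Clifford algebra: the linear isomorphism with the exterior algebra respects
contractions and scalars. -/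
theorem eq_algebraMap_of_contractLeft {I : Type*} [Fintype I] [DecidableEq I]
    {Q : QuadraticForm ℝ (I → ℝ)} {x : CliffordAlgebra Q}
    (hx : ∀ a, contractLeft (Q := Q) (LinearMap.proj a) x = 0) : ∃ c : ℝ, x = algebraMap ℝ _ c := by
  have h := changeForm.associated_neg_proof (Q := Q)
  obtain ⟨c, hc⟩ := exterior_eq_algebraMap_of_contractLeft (x := changeForm h x) fun a => by
    rw [← changeForm_contractLeft, hx, map_zero]
  refine ⟨c, (changeFormEquiv h).injective ?_⟩
  exact hc.trans (changeForm_algebraMap h c).symm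

/-- Twisted commutators with vectors are contractions. -/
theorem ι_mul_sub_involute_mul_ι {R V : Type*} [CommRing R] [AddCommGroup V] [Module R V]
    {Q : QuadraticForm R V} (v : V) (x : CliffordAlgebra Q) :
    ι Q v * x - involute x * ι Q v = contractLeft (Q := Q) (Q.polarBilin v) x := by
  induction x using CliffordAlgebra.left_induction with
  | algebraMap c => rw [contractLeft_algebraMap, AlgHom.commutes, Algebra.commutes, sub_self]
  | add x y hx hy => rw [map_add, map_add, ← hx, ← hy, mul_add, add_mul]; abel
  | ι_mul x m hx =>
    rw [contractLeft_ι_mul, ← hx, map_mul, involute_ι, ← mul_assoc,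
      eq_sub_of_add_eq (ι_mul_ι_add_swap v m), Algebra.smul_def, QuadraticMap.polarBilin_apply_apply]
    noncomm_ring

variable {r s : ℕ}

theorem polarBilin_cliffordForm (v w : SigSpace r s) :
    (cliffordForm r s).polarBilin v w = -(2 * eta v w) := by
  simp only [QuadraticMap.polarBilin_apply_apply, QuadraticMap.polar, cliffordForm_apply, eta,
    Finset.mul_sum, ← Finset.sum_neg_distrib, ← Finset.sum_sub_distrib, Pi.add_apply]
  exact Finset.sum_congr rfl fun a _ => by ring

theorem sgn_mul_self (a : Fin r ⊕ Fin s) : sgn a * sgn a = 1 := by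
  rcases a with a | a <;> simp [sgn]

/-- An even element of the Clifford algebra which commutes with all vectors is a scalar. -/
theorem eq_algebraMap_of_commute {x : Cl r s} (heven : involute x = x)
    (hx : ∀ v, x * vec v = vec v * x) : ∃ c : ℝ, x = algebraMap ℝ _ c := by
  refine eq_algebraMap_of_contractLeft fun a => ?_
  -- the polar form is `-2η`, so the coordinate `a` is the polar form with `-(η_aa / 2) e_a`
  have h1 : (LinearMap.proj a : SigSpace r s →ₗ[ℝ] ℝ) =
      (cliffordForm r s).polarBilin (Pi.single a (-(sgn a / 2))) := by
    refine LinearMap.ext fun w => ?_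
    rw [polarBilin_cliffordForm, eta, Finset.sum_eq_single a]
    · simp only [LinearMap.proj_apply, Pi.single_eq_same]
      linear_combination (-(w a)) * sgn_mul_self a
    · intro b _ hb
      simp [hb]
    · simp
  rw [h1, ← ι_mul_sub_involute_mul_ι, heven]
  exact sub_eq_zero.2 (hx _).symm

theorem IsUnitVec.vec_mul_self {v : SigSpace r s} (hv : IsUnitVec v) :
    vec v * vec v = 1 ∨ vec v * vec v = -1 := by
  rw [ι_sq_scalar, cliffordForm_apply]
  rcases hv with h | h <;> simp [h]

theorem Spin.involute_eq {x : (Cl r s)ˣ} (hx : x ∈ Spin r s) :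
    involute (x : Cl r s) = x := by
  induction hx using Subgroup.closure_induction with
  | mem x hx =>
    obtain ⟨v, w, -, -, h⟩ := hx
    simp [h]
  | one => simp
  | mul x y _ _ hx hy => simp [hx, hy]
  | inv x _ hx =>
    have h : Units.map (involute : Cl r s →ₐ[ℝ] Cl r s).toMonoidHom x = x := Units.ext hx
    have h' := congrArg (fun y : (Cl r s)ˣ => (y⁻¹).val) h
    exact h'

/-- Reversal inverts elements of `Spin(r, s)` up to sign. -/
theorem Spin.reverse_eq {x : (Cl r s)ˣ} (hx : x ∈ Spin r s) :
    reverse (x : Cl r s) = (x⁻¹).val ∨ reverse (x : Cl r s) = -(x⁻¹).val := by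
  induction hx using Subgroup.closure_induction with
  | mem x hx =>
    obtain ⟨v, w, hv, hw, h⟩ := hx
    have h1 : reverse (x : Cl r s) * x = 1 ∨ reverse (x : Cl r s) * x = -1 := by
      have e : reverse (x : Cl r s) * x = vec w * (vec v * vec v) * vec w := by
        rw [h, reverse.map_mul, reverse_ι, reverse_ι]; simp only [mul_assoc]
      rw [e]
      rcases hv.vec_mul_self with h1 | h1 <;> rcases hw.vec_mul_self with h2 | h2 <;>
        simp [h1, h2]
    refine h1.imp (fun h => ?_) fun h => ?_
    · exact Units.eq_inv_of_mul_eq_one_right h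
    · rw [← neg_eq_iff_eq_neg]
      exact Units.eq_inv_of_mul_eq_one_right (by rw [neg_mul, h, neg_neg])
  | one => simp
  | mul x y _ _ hx hy =>
    rw [Units.val_mul, reverse.map_mul, mul_inv_rev, Units.val_mul]
    rcases hx with h1 | h1 <;> rcases hy with h2 | h2 <;> simp [h1, h2]
  | inv x _ hx =>
    have h : reverse ((x⁻¹).val) * reverse (x : Cl r s) = 1 := by
      rw [← reverse.map_mul, Units.mul_inv, reverse.map_one]
    rw [inv_inv]
    refine hx.imp (fun h1 => ?_) fun h1 => ?_
    · rw [h1] at h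
      exact Units.mul_inv_eq_one.1 h
    · rw [h1, mul_neg, ← neg_mul] at h
      exact neg_eq_iff_eq_neg.1 (Units.mul_inv_eq_one.1 h)

/-- The kernel of the covering `Spin(r, s) → SO(r, s)` is `{±1}`. -/
theorem Spin.eq_one_or_eq_neg_one {x : Spin r s} (hx : ∀ v, coverFun x v = v) :
    (x : (Cl r s)ˣ) = 1 ∨ (x : (Cl r s)ˣ) = -1 := by
  obtain ⟨c, hc⟩ := eq_algebraMap_of_commute (Spin.involute_eq x.2) fun v => by
    have h := vec_coverFun x v
    rw [hx] at h
    conv_rhs => rw [h, mul_assoc, Units.inv_mul, mul_one]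
  have hinj := FaithfulSMul.algebraMap_injective ℝ (Cl r s)
  have h1 : c * c = 1 ∨ c * c = -1 := by
    have h2 : ∀ y, reverse (x.1 : Cl r s) = y → y * x.1 = algebraMap ℝ (Cl r s) (c * c) := by
      rintro y rfl
      rw [hc, reverse.commutes, map_mul]
    rcases Spin.reverse_eq x.2 with h | h
    · left
      apply hinj
      rw [← h2 _ h, Units.inv_mul, map_one]
    · right
      apply hinj
      rw [← h2 _ h, neg_mul, Units.inv_mul, map_neg, map_one]
  have h2 : c = 1 ∨ c = -1 := by
    rcases h1 with h | h
    · exact mul_self_eq_one_iff.1 h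
    -- `c` is real, so `c² = -1` does not occur
    · nlinarith
  refine h2.imp (fun h => Units.ext ?_) fun h => Units.ext ?_
  · rw [hc, h]; simp
  · rw [hc, h]; simp

/-! ### The spin representations are faithful -/

namespace DiracMatrices

variable (Γ : DiracMatrices r s)

theorem lin_clifford (v w : SigSpace r s) :
    Γ.lin v * Γ.lin w + Γ.lin w * Γ.lin v = ((-2 * eta v w : ℝ) : ℂ) • 1 := by
  have h := congrArg Γ.cliffordRep (ι_mul_ι_add_swap (Q := cliffordForm r s) v w)
  simp only [map_add, map_mul, cliffordRep, lift_ι_apply, AlgHom.commutes] at h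
  rw [← QuadraticMap.polarBilin_apply_apply, polarBilin_cliffordForm] at h
  rw [h, Algebra.algebraMap_eq_smul_one, ← Complex.coe_smul]
  norm_num

instance (r s : ℕ) : NeZero (dGamma r s) := ⟨by simp [dGamma]⟩

theorem lin_injective : Function.Injective Γ.lin := by
  refine (injective_iff_map_eq_zero Γ.lin).2 fun v hv => funext fun a => ?_
  have h := Γ.lin_clifford v (Pi.single a 1)
  rw [hv, zero_mul, mul_zero, add_zero, eq_comm, smul_eq_zero] at h
  have h1 := h.resolve_right one_ne_zero
  rw [Complex.ofReal_eq_zero, eta, Finset.sum_eq_single a] at h1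
  · have h2 := sgn_mul_self a
    simp only [Pi.single_eq_same, mul_one] at h1
    simp only [Pi.zero_apply]
    linear_combination (-(sgn a / 2)) * h1 - v a * h2
  · intro b _ hb
    simp [hb]
  · simp

/-- The Dirac matrices intertwine the spin representation with the covering of `SO(r, s)`:
`φ(h) γ(v) = γ(Π(h) v) φ(h)`. -/
theorem spinRep_mul_lin (h : Spin r s) (v : SigSpace r s) :
    (Γ.spinRep h).val * Γ.lin v = Γ.lin (spinCover r s h v) * (Γ.spinRep h).val := by
  have h1 : vec (coverFun h v) * h.1.val = h.1.val * vec v := by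
    rw [vec_coverFun, mul_assoc, Units.inv_mul, mul_one]
  have h2 := congrArg Γ.cliffordRep h1
  simp only [map_mul, cliffordRep, lift_ι_apply] at h2
  exact h2.symm

/-- An element of `Spin(r, s)` represented by a scalar matrix is `±1`. -/
theorem eq_one_or_eq_neg_one_of_spinRep {h : Spin r s} {c : ℂ} (hc : (Γ.spinRep h).val = c • 1) :
    (h : (Cl r s)ˣ) = 1 ∨ (h : (Cl r s)ˣ) = -1 := by
  refine Spin.eq_one_or_eq_neg_one fun v => Γ.lin_injective ?_
  have h1 := Γ.spinRep_mul_lin h v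
  have h2 : Γ.lin v * (Γ.spinRep h).val = Γ.lin (coverFun h v) * (Γ.spinRep h).val := by
    refine Eq.trans ?_ h1
    rw [hc, smul_mul_assoc, mul_smul_comm, one_mul, mul_one]
  exact ((Γ.spinRep h).isUnit.mul_left_injective h2).symm

theorem spinRep_injective : Function.Injective Γ.spinRep := by
  refine (injective_iff_map_eq_one Γ.spinRep).2 fun h hh => Subtype.ext ?_
  refine (Γ.eq_one_or_eq_neg_one_of_spinRep (c := 1) (by rw [hh]; simp)).resolve_right fun h1 => ?_
  have h2 : (Γ.spinRep h).val = -1 := by simp [spinRep, h1]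
  have h3 := smul_left_injective ℂ (one_ne_zero (α := Matrix (Fin (dGamma r s)) (Fin (dGamma r s)) ℂ))
    (a₁ := 1) (a₂ := -1) (by simp [← h2, hh])
  norm_num at h3

theorem spinCRep_mk (h : Spin r s) (u : Circle) :
    (Γ.spinCRep (QuotientGroup.mk (h, u))).val = (u : ℂ) • (Γ.spinRep h).val :=
  (Algebra.smul_def _ _).symm

theorem spinCRep_mul_lin (h : SpinC r s) (v : SigSpace r s) :
    (Γ.spinCRep h).val * Γ.lin v = Γ.lin (spinCCover r s h v) * (Γ.spinCRep h).val := by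
  obtain ⟨⟨h, u⟩, rfl⟩ := QuotientGroup.mk_surjective h
  rw [spinCRep_mk, smul_mul_assoc, mul_smul_comm, spinRep_mul_lin]
  rfl

theorem spinCRep_injective : Function.Injective Γ.spinCRep := by
  refine (injective_iff_map_eq_one Γ.spinCRep).2 fun h hh => ?_
  obtain ⟨⟨h, u⟩, rfl⟩ := QuotientGroup.mk_surjective h
  have h1 : (u : ℂ) • (Γ.spinRep h).val = 1 := by rw [← spinCRep_mk, hh, Units.val_one]
  have h2 : (Γ.spinRep h).val = (u : ℂ)⁻¹ • 1 := by
    rw [← h1, smul_smul, inv_mul_cancel₀ u.coe_ne_zero, one_smul]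
  refine (QuotientGroup.eq_one_iff _).2 ?_
  rcases Γ.eq_one_or_eq_neg_one_of_spinRep h2 with h3 | h3
  · have h4 : (Γ.spinRep h).val = 1 := by simp [spinRep, h3]
    refine Or.inl ⟨h3, ?_⟩
    rw [h4] at h1
    exact smul_left_injective ℂ
      (one_ne_zero (α := Matrix (Fin (dGamma r s)) (Fin (dGamma r s)) ℂ))
      (h1.trans (one_smul ℂ _).symm)
  · have h4 : (Γ.spinRep h).val = -1 := by simp [spinRep, h3]
    refine Or.inr ⟨h3, ?_⟩
    rw [h4, smul_neg, ← neg_smul] at h1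
    exact neg_eq_iff_eq_neg.1 (smul_left_injective ℂ
      (one_ne_zero (α := Matrix (Fin (dGamma r s)) (Fin (dGamma r s)) ℂ))
      (h1.trans (one_smul ℂ _).symm))

end DiracMatrices

end Clifford

open Bundle

/-! ### Smooth maps of vector bundles and smooth sections of `T*M ⊗ End(E)` -/

section VectorBundles

variable {n : ℕ} {M : Type*} [TopologicalSpace M] [ChartedSpace (EuclideanSpace ℝ (Fin n)) M]
  {F F' : Type*} [NormedAddCommGroup F] [NormedSpace ℝ F]
  [NormedAddCommGroup F'] [NormedSpace ℝ F']

/-- The pointwise inverse of a smooth family of operators is smooth where the operators are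
invertible. -/
theorem contMDiffAt_clm_inverse [CompleteSpace F] {L : M → F →L[ℝ] F'} {x₀ : M}
    (hL : ContMDiffAt (𝓡 n) 𝓘(ℝ, F →L[ℝ] F') ∞ L x₀) (K : F ≃L[ℝ] F') (hK : (K : F →L[ℝ] F') = L x₀) :
    ContMDiffAt (𝓡 n) 𝓘(ℝ, F' →L[ℝ] F) ∞ (fun x => ContinuousLinearMap.inverse (L x)) x₀ := by
  have h := contDiffAt_map_inverse (𝕜 := ℝ) (n := ∞) K
  rw [hK] at h
  exact h.contMDiffAt.comp x₀ hL

variable [FiniteDimensional ℝ F] {E E' : M → Type*}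
  [∀ x, AddCommGroup (E x)] [∀ x, Module ℝ (E x)] [TopologicalSpace (TotalSpace F E)]
  [∀ x, TopologicalSpace (E x)] [FiberBundle F E] [VectorBundle ℝ F E]
  [ContMDiffVectorBundle ∞ F E (𝓡 n)]
  [∀ x, AddCommGroup (E' x)] [∀ x, Module ℝ (E' x)] [TopologicalSpace (TotalSpace F' E')]
  [∀ x, TopologicalSpace (E' x)] [FiberBundle F' E'] [VectorBundle ℝ F' E']
  [ContMDiffVectorBundle ∞ F' E' (𝓡 n)]

/-- A fibrewise linear map of vector bundles is smooth if it sends the sections which are constant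
in local trivializations to smooth sections. -/
theorem contMDiff_of_contMDiffOn_symm (θ : ∀ x, E x →ₗ[ℝ] E' x)
    (h : ∀ x₀, ∃ e : Trivialization F (π F E), MemTrivializationAtlas e ∧ x₀ ∈ e.baseSet ∧
      ∀ v, ContMDiffOn (𝓡 n) ((𝓡 n).prod 𝓘(ℝ, F')) ∞
        (fun x => (⟨x, θ x (e.symm x v)⟩ : TotalSpace F' E')) e.baseSet) :
    ContMDiff ((𝓡 n).prod 𝓘(ℝ, F)) ((𝓡 n).prod 𝓘(ℝ, F')) ∞
      (fun z : TotalSpace F E => (⟨z.1, θ z.1 z.2⟩ : TotalSpace F' E')) := by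
  intro z₀
  obtain ⟨e, he, hx₀, h⟩ := h z₀.1
  let e' := trivializationAt F' E' z₀.1
  have hx₀' : z₀.1 ∈ e'.baseSet := mem_baseSet_trivializationAt F' E' z₀.1
  have hproj : ContMDiffAt ((𝓡 n).prod 𝓘(ℝ, F)) (𝓡 n) ∞ (fun z : TotalSpace F E => z.1) z₀ :=
    Bundle.contMDiffAt_proj E
  refine Bundle.contMDiffAt_totalSpace.2 ⟨hproj, ?_⟩
  let b := Module.finBasis ℝ F
  have hsnd : ContMDiffAt ((𝓡 n).prod 𝓘(ℝ, F)) 𝓘(ℝ, F) ∞ (fun z : TotalSpace F E => (e z).2) z₀ :=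
    contMDiffAt_snd.comp z₀ (e.contMDiffOn.contMDiffAt
      (e.open_source.mem_nhds (e.mem_source.2 hx₀)))
  have hcoord : ∀ i, ContMDiffAt ((𝓡 n).prod 𝓘(ℝ, F)) 𝓘(ℝ) ∞
      (fun z : TotalSpace F E => b.coord i (e z).2) z₀ := fun i =>
    (LinearMap.toContinuousLinearMap (b.coord i)).contMDiff.contMDiffAt.comp z₀ hsnd
  have hsec : ∀ i, ContMDiffAt ((𝓡 n).prod 𝓘(ℝ, F)) 𝓘(ℝ, F') ∞
      (fun z : TotalSpace F E => (e' ⟨z.1, θ z.1 (e.symm z.1 (b i))⟩).2) z₀ := fun i => by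
    have h1 := (h (b i)).contMDiffAt (e.open_baseSet.mem_nhds hx₀)
    exact ContMDiffAt.comp (f := fun z : TotalSpace F E => z.1)
      (g := fun x => (e' ⟨x, θ x (e.symm x (b i))⟩).2) z₀ ((e'.contMDiffAt_section_iff hx₀').1 h1)
      hproj
  have hsum : ContMDiffAt ((𝓡 n).prod 𝓘(ℝ, F)) 𝓘(ℝ, F') ∞ (fun z : TotalSpace F E =>
      ∑ i, b.coord i (e z).2 • (e' ⟨z.1, θ z.1 (e.symm z.1 (b i))⟩).2) z₀ :=
    contMDiffAt_finsetSum fun i _ => (hcoord i).smul (hsec i)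
  refine hsum.congr_of_eventuallyEq ?_
  have hopen : (π F E) ⁻¹' (e.baseSet ∩ e'.baseSet) ∈ nhds z₀ :=
    (FiberBundle.continuous_proj F E).continuousAt.preimage_mem_nhds
      ((e.open_baseSet.inter e'.open_baseSet).mem_nhds ⟨hx₀, hx₀'⟩)
  filter_upwards [hopen] with z hz
  have hz1 : z.1 ∈ e.baseSet := hz.1
  have hz2 : z.1 ∈ e'.baseSet := hz.2
  have e1 : ∀ y : E' z.1, (e' ⟨z.1, y⟩).2 = e'.linearMapAt ℝ z.1 y := fun y => by
    rw [e'.coe_linearMapAt_of_mem hz2]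
  have e2 : z.2 = e.symmₗ ℝ z.1 (e z).2 := by
    have h3 := e.symmₗ_linearMapAt (R := ℝ) hz1 z.2
    rw [e.coe_linearMapAt_of_mem hz1] at h3
    exact h3.symm
  change (e' ⟨z.1, θ z.1 z.2⟩).2 = _
  simp only [e1]
  conv_lhs => rw [e2, ← b.sum_repr (e z).2]
  simp only [map_sum, map_smul]
  refine Finset.sum_congr rfl fun i _ => ?_
  rw [e.symmₗ_apply hz1, b.coord_apply]

/-- A smooth map of vector bundles which is a linear isomorphism on each fibre has a smooth
inverse. -/
theorem contMDiff_symm_of_linearEquiv [FiniteDimensional ℝ F'] (θ : ∀ x, E x ≃ₗ[ℝ] E' x)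
    (h : ContMDiff ((𝓡 n).prod 𝓘(ℝ, F)) ((𝓡 n).prod 𝓘(ℝ, F')) ∞
      (fun z : TotalSpace F E => (⟨z.1, θ z.1 z.2⟩ : TotalSpace F' E'))) :
    ContMDiff ((𝓡 n).prod 𝓘(ℝ, F')) ((𝓡 n).prod 𝓘(ℝ, F)) ∞
      (fun z : TotalSpace F' E' => (⟨z.1, (θ z.1).symm z.2⟩ : TotalSpace F E)) := by
  have : CompleteSpace F := FiniteDimensional.complete ℝ F
  refine contMDiff_of_contMDiffOn_symm (fun x => (θ x).symm.toLinearMap) fun x₁ =>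
    ⟨trivializationAt F' E' x₁, inferInstance, mem_baseSet_trivializationAt F' E' x₁,
      fun v x₀ hx₀' => ContMDiffAt.contMDiffWithinAt ?_⟩
  set e' := trivializationAt F' E' x₁
  let e := trivializationAt F E x₀
  have hx₀ : x₀ ∈ e.baseSet := mem_baseSet_trivializationAt F E x₀
  have hO : e.baseSet ∩ e'.baseSet ∈ nhds x₀ :=
    (e.open_baseSet.inter e'.open_baseSet).mem_nhds ⟨hx₀, hx₀'⟩
  -- `θ` in the two trivializations
  let L : M → F →L[ℝ] F' := fun x => LinearMap.toContinuousLinearMap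
    ((e'.linearMapAt ℝ x).comp ((θ x).toLinearMap.comp (e.symmₗ ℝ x)))
  have hL : ContMDiffAt (𝓡 n) 𝓘(ℝ, F →L[ℝ] F') ∞ L x₀ := by
    refine (contMDiffOn_clm_of_apply (𝕜 := ℝ) (U := e.baseSet ∩ e'.baseSet)
      fun w => ?_).contMDiffAt hO
    have h1 : ContMDiffOn (𝓡 n) ((𝓡 n).prod 𝓘(ℝ, F)) ∞
        (fun x => (⟨x, e.symm x w⟩ : TotalSpace F E)) e.baseSet :=
      e.contMDiffOn_section_baseSet_iff.2 ((contMDiffOn_const (c := w)).congr fun x hx => by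
        rw [e.apply_mk_symm hx])
    have h2 := (h.comp_contMDiffOn h1).mono (Set.inter_subset_left (t := e'.baseSet))
    refine ((e'.contMDiffOn_section_iff (e.open_baseSet.inter e'.open_baseSet)
      Set.inter_subset_right).1 h2).congr fun x hx => ?_
    change e'.linearMapAt ℝ x (θ x (e.symmₗ ℝ x w)) = (e' ⟨x, θ x (e.symm x w)⟩).2
    rw [e'.coe_linearMapAt_of_mem hx.2, e.symmₗ_apply hx.1]
  let K : ∀ x ∈ e.baseSet ∩ e'.baseSet, F ≃L[ℝ] F' := fun x hx =>
    ((e.linearEquivAt ℝ x hx.1).symm.trans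
      ((θ x).trans (e'.linearEquivAt ℝ x hx.2))).toContinuousLinearEquiv
  have hK : ∀ x hx, (K x hx : F →L[ℝ] F') = L x := fun x hx => by
    ext w
    change (e' ⟨x, θ x (e.symm x w)⟩).2 = e'.linearMapAt ℝ x (θ x (e.symmₗ ℝ x w))
    rw [e'.coe_linearMapAt_of_mem hx.2, e.symmₗ_apply hx.1]
  have hinv := contMDiffAt_clm_inverse hL (K x₀ ⟨hx₀, hx₀'⟩) (hK x₀ ⟨hx₀, hx₀'⟩)
  refine (e.contMDiffAt_section_iff hx₀).2 ?_
  refine (hinv.clm_apply (contMDiffAt_const (c := v))).congr_of_eventuallyEq ?_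
  filter_upwards [hO] with x hx
  rw [← hK x hx, ContinuousLinearMap.inverse_equiv]
  rfl

end VectorBundles

section GammaSections

variable {r s : ℕ} {M : Type u} [TopologicalSpace M]
  [ChartedSpace (EuclideanSpace ℝ (Fin (r + s))) M] [IsManifold (𝓡 (r + s)) ∞ M]

/-- The coordinates of a tangent vector with respect to a smooth frame of `TM` depend smoothly on
the base point. -/
theorem exists_frame_coordinates {U : Set M} (hU : IsOpen U)
    {f : ∀ x : M, SigSpace r s ≃ₗ[ℝ] TSpace r s x} (hf : ∀ v, SmoothFieldOn (fun x => f x v) U)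
    {x₀ : M} (hx₀ : x₀ ∈ U) :
    ∃ K : M → EuclideanSpace ℝ (Fin (r + s)) →L[ℝ] SigSpace r s,
      ContMDiffAt (𝓡 (r + s)) 𝓘(ℝ, EuclideanSpace ℝ (Fin (r + s)) →L[ℝ] SigSpace r s) ∞ K x₀ ∧
      ∀ x ∈ (trivializationAt (EuclideanSpace ℝ (Fin (r + s)))
          (TangentSpace (𝓡 (r + s)) : M → Type) x₀).baseSet, ∀ w,
        f x (K x w) = (trivializationAt (EuclideanSpace ℝ (Fin (r + s)))
          (TangentSpace (𝓡 (r + s)) : M → Type) x₀).symm x w := by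
  set e := trivializationAt (EuclideanSpace ℝ (Fin (r + s)))
    (TangentSpace (𝓡 (r + s)) : M → Type) x₀
  have he : x₀ ∈ e.baseSet := mem_baseSet_trivializationAt _ _ _
  have hO : e.baseSet ∩ U ∈ nhds x₀ := (e.open_baseSet.inter hU).mem_nhds ⟨he, hx₀⟩
  -- the frame in the trivialization of `TM`
  let L : M → SigSpace r s →L[ℝ] EuclideanSpace ℝ (Fin (r + s)) := fun x =>
    LinearMap.toContinuousLinearMap ((e.linearMapAt ℝ x).comp (f x).toLinearMap)
  have hLx : ∀ x ∈ e.baseSet, ∀ w, L x w = (e ⟨x, f x w⟩).2 := fun x hx w => by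
    simp [L, e.coe_linearMapAt_of_mem hx]
  have hL : ContMDiffAt (𝓡 (r + s)) 𝓘(ℝ, SigSpace r s →L[ℝ] EuclideanSpace ℝ (Fin (r + s))) ∞
      L x₀ := by
    refine (contMDiffOn_clm_of_apply (𝕜 := ℝ) (U := e.baseSet ∩ U) fun w => ?_).contMDiffAt hO
    have h1 := ((hf w).mono (Set.inter_subset_right (s := e.baseSet)))
    exact ((e.contMDiffOn_section_iff (e.open_baseSet.inter hU) Set.inter_subset_left).1 h1).congr
      fun x hx => hLx x hx.1 w
  let K : ∀ x ∈ e.baseSet, SigSpace r s ≃L[ℝ] EuclideanSpace ℝ (Fin (r + s)) := fun x hx =>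
    ((f x).trans (e.linearEquivAt ℝ x hx)).toContinuousLinearEquiv
  have hK : ∀ x (hx : x ∈ e.baseSet), (K x hx : SigSpace r s →L[ℝ] _) = L x := fun x hx => by
    ext1 w
    rw [hLx x hx]
    rfl
  refine ⟨_, contMDiffAt_clm_inverse hL (K x₀ he) (hK x₀ he), fun x hx w => ?_⟩
  rw [← hK x hx, ContinuousLinearMap.inverse_equiv]
  exact (f x).apply_symm_apply _

variable {d : ℕ} {E : M → Type*} [∀ x, AddCommGroup (E x)] [∀ x, Module ℂ (E x)]
  [∀ x, TopologicalSpace (E x)] [∀ x, IsTopologicalAddGroup (E x)] [∀ x, ContinuousSMul ℂ (E x)]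
  [TopologicalSpace (TotalSpace (Spinor d) E)] [FiberBundle (Spinor d) E]
  [VectorBundle ℂ (Spinor d) E] [VectorBundle ℝ (Spinor d) E]
  [ContMDiffVectorBundle ∞ (Spinor d) E (𝓡 (r + s))]

set_option synthInstance.maxHeartbeats 400000 in
set_option maxHeartbeats 1000000 in
/-- A section of `T*M ⊗ End(E)` is smooth if it has constant components `T` with respect to a smooth
frame of `TM` and a local trivialization of `E`. -/
theorem contMDiffOn_gammaFiber {U : Set M} (hU : IsOpen U)
    {f : ∀ x : M, SigSpace r s ≃ₗ[ℝ] TSpace r s x} (hf : ∀ v, SmoothFieldOn (fun x => f x v) U)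
    (e : Trivialization (Spinor d) (π (Spinor d) E)) [MemTrivializationAtlas e]
    (T : GammaModel r s d) (γ : ∀ x : M, GammaFiber r s E x)
    (hγ : ∀ x ∈ U ∩ e.baseSet, ∀ v ψ, γ x (f x v) (e.symm x ψ) = e.symm x (T.op v ψ)) :
    ContMDiffOn (𝓡 (r + s)) ((𝓡 (r + s)).prod 𝓘(ℝ, GammaTarget r s d)) ∞
      (fun x => (⟨x, γ x⟩ : TotalSpace (GammaTarget r s d) (GammaFiber r s E)))
      (U ∩ e.baseSet) := by
  intro x₀ hx₀
  apply ContMDiffAt.contMDiffWithinAt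
  refine (contMDiffAt_hom_bundle _).2 ⟨contMDiffAt_id, ?_⟩
  obtain ⟨K, hK, hfK⟩ := exists_frame_coordinates hU hf hx₀.1
  set e₁ := trivializationAt (EuclideanSpace ℝ (Fin (r + s)))
    (TangentSpace (𝓡 (r + s)) : M → Type) x₀ with he₁
  let e₂ := trivializationAt (Spinor d) E x₀
  have h₁ : x₀ ∈ e₁.baseSet := mem_baseSet_trivializationAt _ _ _
  have h₂ : x₀ ∈ e₂.baseSet := mem_baseSet_trivializationAt _ _ _
  have hO : e.baseSet ∩ e₂.baseSet ∈ nhds x₀ :=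
    (e.open_baseSet.inter e₂.open_baseSet).mem_nhds ⟨hx₀.2, h₂⟩
  -- in the trivializations at `x₀` the section is `T`, composed with the coordinates of tangent
  -- vectors and conjugated by the transition from `e` to the trivialization `e₂` of `E`
  have hconj : ContMDiffAt (𝓡 (r + s))
      𝓘(ℝ, (Spinor d →L[ℂ] Spinor d) →L[ℝ] (Spinor d →L[ℂ] Spinor d)) ∞
      (fun x => conjL (e₂.coordChangeL ℂ e x : Spinor d →L[ℂ] Spinor d)
        (e.coordChangeL ℂ e₂ x : Spinor d →L[ℂ] Spinor d)) x₀ :=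
    (conjL_smooth ((contMDiffOn_coordChange_complex (n := r + s) e₂ e).mono
      (fun x hx => ⟨hx.2, hx.1⟩)) (contMDiffOn_coordChange_complex (n := r + s) e e₂)).contMDiffAt hO
  have key := hconj.clm_comp ((contMDiffAt_const (c := T.op)).clm_comp hK)
  refine key.congr_of_eventuallyEq ?_
  filter_upwards [e₁.open_baseSet.mem_nhds h₁, hO, hU.mem_nhds hx₀.1] with x hx hx' hxU
  refine ContinuousLinearMap.ext fun w => ContinuousLinearMap.ext fun ψ => ?_
  have hψ : e₂.symm x ψ = e.symm x (e₂.coordChangeL ℂ e x ψ) := by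
    rw [e₂.coordChangeL_apply e ⟨hx'.2, hx'.1⟩]
    exact (e.symm_apply_apply_mk hx'.1 _).symm
  have h3 : γ x (e₁.symm x w) (e₂.symm x ψ) =
      e.symm x (T.op (K x w) (e₂.coordChangeL ℂ e x ψ)) := by
    rw [hψ, ← hγ x ⟨hxU, hx'.1⟩, hfK x hx]
  have h4 : ContinuousLinearMap.inCoordinates (EuclideanSpace ℝ (Fin (r + s)))
      (TangentSpace (𝓡 (r + s)) : M → Type) (Spinor d →L[ℂ] Spinor d) (fun x => E x →L[ℂ] E x)
      x₀ x x₀ x (γ x) w ψ = (e₂ ⟨x, γ x (e₁.symm x w) (e₂.symm x ψ)⟩).2 := by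
    have hxE : x ∈ (trivializationAt (Spinor d →L[ℂ] Spinor d) (fun x => E x →L[ℂ] E x) x₀).baseSet :=
      ⟨hx'.2, hx'.2⟩
    rw [ContinuousLinearMap.inCoordinates_eq hx hxE]
    change e₂.continuousLinearMapAt ℂ x (γ x (e₁.symm x w) (e₂.symmL ℂ x ψ)) = _
    rw [e₂.symmL_apply hx'.2, e₂.continuousLinearMapAt_apply ℂ, e₂.coe_linearMapAt_of_mem hx'.2]
  refine h4.trans ?_
  rw [h3]
  exact (e.coordChangeL_apply e₂ hx' _).symm

end GammaSections

/-! ### Local trivializations of associated bundles -/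

namespace Assoc

variable {n : ℕ} {M : Type u} [TopologicalSpace M] [ChartedSpace (EuclideanSpace ℝ (Fin n)) M]
  {G : Type*} [Group G] [SmoothTarget n M G]
  {F : Type w'} [NormedAddCommGroup F] [NormedSpace ℂ F]

theorem frameL_symm_mk (P : PrincipalBundle.{u, w} n M G) (ρ : SmoothRep n M G F) {x : M}
    (p : P.Fiber x) (v : F) : (frameL P ρ p).symm (mk P ρ p v) = v := by
  rw [← frameL_apply, ContinuousLinearEquiv.symm_apply_apply]

/-- A local section `σ` of `P` in the atlas gives a local trivialization of `P ×_ρ F` whose inverse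
is `(x, v) ↦ [σ(x), v]`. -/
theorem exists_trivialization (P : PrincipalBundle.{u, w} n M G) (ρ : SmoothRep n M G F)
    {σ : TopologicalSpace.Opens M × ∀ x, P.Fiber x} (hσ : σ ∈ P.atlas) :
    ∃ e : Trivialization F (π F (Assoc P ρ)), MemTrivializationAtlas e ∧ e.baseSet = σ.1 ∧
      ∀ x ∈ σ.1, ∀ v, e.symm x v = mk P ρ (σ.2 x) v :=
  ⟨(prebundle P ρ).trivializationOfMemPretrivializationAtlas ⟨σ, hσ, rfl⟩, ⟨_, ⟨σ, hσ, rfl⟩, rfl⟩,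
    rfl, fun _ hx v => pretriv_symm P ρ σ hx v⟩

/-- The local sections `x ↦ [σ(x), v]` of `P ×_ρ F` are smooth. -/
theorem contMDiffOn_mk (P : PrincipalBundle.{u, w} n M G) (ρ : SmoothRep n M G F)
    {σ : TopologicalSpace.Opens M × ∀ x, P.Fiber x} (hσ : σ ∈ P.atlas) (v : F) :
    ContMDiffOn (𝓡 n) ((𝓡 n).prod 𝓘(ℝ, F)) ∞
      (fun x => (⟨x, mk P ρ (σ.2 x) v⟩ : TotalSpace F (Assoc P ρ))) σ.1 := by
  obtain ⟨e, he, hbase, hsymm⟩ := exists_trivialization P ρ hσ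
  rw [← hbase]
  refine e.contMDiffOn_section_baseSet_iff.2 ((contMDiffOn_const (c := v)).congr fun x hx => ?_)
  rw [← hsymm x (by rwa [hbase] at hx), e.apply_mk_symm hx]

/-- A fibrewise linear map out of an associated bundle is smooth if the images of the local sections
`x ↦ [σ(x), v]` are smooth. -/
theorem contMDiff_of_contMDiffOn_mk [FiniteDimensional ℝ F] (P : PrincipalBundle.{u, w} n M G)
    (ρ : SmoothRep n M G F) {F' : Type*} [NormedAddCommGroup F'] [NormedSpace ℝ F']
    {E' : M → Type*} [∀ x, AddCommGroup (E' x)] [∀ x, Module ℝ (E' x)]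
    [TopologicalSpace (TotalSpace F' E')] [∀ x, TopologicalSpace (E' x)] [FiberBundle F' E']
    [VectorBundle ℝ F' E'] [ContMDiffVectorBundle ∞ F' E' (𝓡 n)]
    (θ : ∀ x, Assoc P ρ x →ₗ[ℝ] E' x)
    (h : ∀ σ ∈ P.atlas, ∀ v, ContMDiffOn (𝓡 n) ((𝓡 n).prod 𝓘(ℝ, F')) ∞
      (fun x => (⟨x, θ x (mk P ρ (σ.2 x) v)⟩ : TotalSpace F' E')) σ.1) :
    ContMDiff ((𝓡 n).prod 𝓘(ℝ, F)) ((𝓡 n).prod 𝓘(ℝ, F')) ∞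
      (fun z : TotalSpace F (Assoc P ρ) => (⟨z.1, θ z.1 z.2⟩ : TotalSpace F' E')) := by
  refine contMDiff_of_contMDiffOn_symm θ fun x₀ => ?_
  obtain ⟨σ, hσ, hx₀⟩ := P.cover x₀
  obtain ⟨e, he, hbase, hsymm⟩ := exists_trivialization P ρ hσ
  refine ⟨e, he, hbase ▸ hx₀, fun v => ?_⟩
  rw [hbase]
  exact (h σ hσ v).congr fun x hx => by rw [hsymm x hx]

end Assoc

/-! ### The bundle of frames of the spinor bundle -/

section FrameBundle

variable {n : ℕ} {M : Type u} [TopologicalSpace M] [ChartedSpace (EuclideanSpace ℝ (Fin n)) M]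
  {G : Type*} [Group G] [SmoothTarget n M G] {d : ℕ}

theorem glRep_apply (A : GL (Fin d) ℂ) (ψ : Spinor d) :
    (glRep n M d).rep A ψ = matOp d A.val ψ := rfl

/-- `GL(d, ℂ)` acts simply transitively on the complex frames of a vector space. -/
theorem existsUnique_glRep {V : Type*} [AddCommGroup V] [Module ℂ V] (f f' : Spinor d ≃ₗ[ℂ] V) :
    ∃! A : GL (Fin d) ℂ, (Assoc.repL (glRep n M d) A).toLinearEquiv.trans f = f' := by
  let t : (Spinor d →ₗ[ℂ] Spinor d) ≃ₐ[ℂ] Matrix (Fin d) (Fin d) ℂ :=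
    LinearMap.toMatrixAlgEquiv' (R := ℂ) (n := Fin d)
  have ht : ∀ (L : Spinor d →ₗ[ℂ] Spinor d) ψ, matOp d (t L) ψ = L ψ := fun L ψ =>
    congrFun (congrArg DFunLike.coe (t.symm_apply_apply L)) ψ
  refine ⟨⟨t (f'.trans f.symm).toLinearMap, t (f.trans f'.symm).toLinearMap, ?_, ?_⟩, ?_, ?_⟩
  · rw [← map_mul, ← map_one t]
    exact congrArg t (LinearMap.ext fun v => by simp)
  · rw [← map_mul, ← map_one t]
    exact congrArg t (LinearMap.ext fun v => by simp)
  · refine LinearEquiv.ext fun ψ => ?_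
    change f (matOp d (t (f'.trans f.symm).toLinearMap) ψ) = f' ψ
    rw [ht]
    simp
  · rintro A rfl
    refine Units.ext (t.symm.injective (LinearMap.ext fun ψ => ?_))
    change matOp d A.val ψ = matOp d (t _) ψ
    rw [ht]
    simp only [LinearEquiv.coe_coe, LinearEquiv.trans_apply, LinearEquiv.symm_apply_apply]
    rfl

variable (P : PrincipalBundle.{u, w} n M G) (φ : G →* GL (Fin d) ℂ)
  (hφ : ∀ (h : M → G) (U : Set M), SmoothTarget.SmoothOn n h U →
    SmoothTarget.SmoothOn n (fun x => φ (h x)) U)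

/-- The frame `ψ ↦ [p, ψ]` of `P ×_φ ℂ^d`. -/
def spinorFrame {x : M} (p : P.Fiber x) : Spinor d ≃ₗ[ℂ] Assoc P ((glRep n M d).comap φ hφ) x :=
  (Assoc.frameL P _ p).toLinearEquiv

theorem spinorFrame_apply {x : M} (p : P.Fiber x) (ψ : Spinor d) :
    spinorFrame P φ hφ p ψ = Assoc.mk P _ p ψ :=
  Assoc.frameL_apply P _ p ψ

theorem spinorFrame_act {x : M} (p : P.Fiber x) (h : G) :
    spinorFrame P φ hφ (P.act p h) =
      (Assoc.repL (glRep n M d) (φ h)).toLinearEquiv.trans (spinorFrame P φ hφ p) := by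
  refine LinearEquiv.ext fun ψ => ?_
  rw [LinearEquiv.trans_apply, spinorFrame_apply, spinorFrame_apply, Assoc.mk_act]
  rfl

/-- The principal `GL(d, ℂ)`-bundle of all complex frames `ℂ^d ≃ E_x` of `E = P ×_φ ℂ^d`, which is
(isomorphic to) the extension `P ×_φ GL(d, ℂ)` of `P`. Its atlas consists of the frames given by the
local sections in the atlas of `P`. -/
def spinorFrameBundle : PrincipalBundle.{u, w} n M (GL (Fin d) ℂ) where
  Fiber x := Spinor d ≃ₗ[ℂ] Assoc P ((glRep n M d).comap φ hφ) x
  act f A := (Assoc.repL (glRep n M d) A).toLinearEquiv.trans f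
  act_one f := LinearEquiv.ext fun ψ => by
    change f ((glRep n M d).rep 1 ψ) = f ψ
    rw [map_one]
    rfl
  act_mul f A B := LinearEquiv.ext fun ψ => by
    change f ((glRep n M d).rep (A * B) ψ) = f ((glRep n M d).rep A ((glRep n M d).rep B ψ))
    rw [map_mul]
    rfl
  existsUnique_act f f' := existsUnique_glRep f f'
  atlas := {τ | ∃ σ ∈ P.atlas, τ = (σ.1, fun x => spinorFrame P φ hφ (σ.2 x))}
  cover x := by
    obtain ⟨σ, hσ, hx⟩ := P.cover x
    exact ⟨_, ⟨σ, hσ, rfl⟩, hx⟩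
  smooth_transition := by
    rintro _ ⟨σ, hσ, rfl⟩ _ ⟨τ, hτ, rfl⟩
    obtain ⟨h, hh, hs⟩ := P.smooth_transition σ hσ τ hτ
    refine ⟨fun x => φ (h x), fun x hx => ?_, hφ h _ hs⟩
    exact (spinorFrame_act P φ hφ _ _).symm.trans (congrArg _ (hh x hx))

/-- The inclusion `ι` of `P` into the frame bundle of `P ×_φ ℂ^d`: the point `p` goes to the frame
`ψ ↦ [p, ψ]`. -/
def frameInclusion {x : M} (p : P.Fiber x) : (spinorFrameBundle P φ hφ).Fiber x :=
  spinorFrame P φ hφ p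

theorem frameInclusion_act {x : M} (p : P.Fiber x) (h : G) :
    frameInclusion P φ hφ (P.act p h) =
      (spinorFrameBundle P φ hφ).act (frameInclusion P φ hφ p) (φ h) :=
  spinorFrame_act P φ hφ p h

theorem frameInclusion_injective (hinj : Function.Injective φ) {x : M} :
    Function.Injective (frameInclusion P φ hφ (x := x)) := by
  intro p q hpq
  obtain ⟨h, rfl, -⟩ := P.existsUnique_act p q
  rw [frameInclusion_act] at hpq
  have h1 : φ h = 1 := ((spinorFrameBundle P φ hφ).existsUnique_act _ _).unique hpq.symm
    ((spinorFrameBundle P φ hφ).act_one _)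
  rw [hinj (h1.trans (map_one φ).symm), P.act_one]

theorem frameInclusion_mem_atlas {σ : TopologicalSpace.Opens M × ∀ x, P.Fiber x}
    (hσ : σ ∈ P.atlas) : (σ.1, fun x => frameInclusion P φ hφ (σ.2 x)) ∈
      (spinorFrameBundle P φ hφ).atlas :=
  ⟨σ, hσ, rfl⟩

theorem isSmoothSectionOn_frameInclusion {σ : TopologicalSpace.Opens M × ∀ x, P.Fiber x}
    (hσ : σ ∈ P.atlas) : (spinorFrameBundle P φ hφ).IsSmoothSectionOn (σ.1 : Set M)
      (fun x => frameInclusion P φ hφ (σ.2 x)) := fun τ hτ =>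
  (spinorFrameBundle P φ hφ).smooth_transition τ hτ _ (frameInclusion_mem_atlas P φ hφ hσ)

/-- The isomorphism `[p, ψ] ↦ [ι(p), ψ]` from `E = P ×_φ ℂ^d` to the bundle associated to the frame
bundle of `E`, on the fibre over `x`. The auxiliary frame does not matter, see
`extensionEquiv_mk`. -/
def extensionEquiv (x : M) : Assoc P ((glRep n M d).comap φ hφ) x ≃ₗ[ℂ]
    Assoc (spinorFrameBundle P φ hφ) (glRep n M d) x :=
  (spinorFrame P φ hφ (Assoc.someFrame P x)).symm.trans
    (Assoc.frameL (spinorFrameBundle P φ hφ) (glRep n M d)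
      (frameInclusion P φ hφ (Assoc.someFrame P x))).toLinearEquiv

theorem mk_frameInclusion_act {x : M} (p : P.Fiber x) (h : G) (ψ : Spinor d) :
    Assoc.mk (spinorFrameBundle P φ hφ) (glRep n M d) (frameInclusion P φ hφ (P.act p h)) ψ =
      Assoc.mk (spinorFrameBundle P φ hφ) (glRep n M d) (frameInclusion P φ hφ p)
        (matOp d (φ h).val ψ) := by
  rw [frameInclusion_act, Assoc.mk_act, glRep_apply]

theorem extensionEquiv_mk {x : M} (p : P.Fiber x) (ψ : Spinor d) :
    extensionEquiv P φ hφ x (Assoc.mk P _ p ψ) =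
      Assoc.mk (spinorFrameBundle P φ hφ) (glRep n M d) (frameInclusion P φ hφ p) ψ := by
  obtain ⟨h, rfl, -⟩ := P.existsUnique_act (Assoc.someFrame P x) p
  rw [mk_frameInclusion_act, Assoc.mk_act, ← spinorFrame_apply, extensionEquiv,
    LinearEquiv.trans_apply, LinearEquiv.symm_apply_apply]
  exact Assoc.frameL_apply _ _ _ _

theorem isSmoothIso_extensionEquiv : IsSmoothIso (n := n) (F := Spinor d) (F' := Spinor d)
    (fun x => (extensionEquiv P φ hφ x).toEquiv) := by
  have h := Assoc.contMDiff_of_contMDiffOn_mk P ((glRep n M d).comap φ hφ)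
    (fun x => ((extensionEquiv P φ hφ x).restrictScalars ℝ).toLinearMap) fun σ hσ ψ =>
      (Assoc.contMDiffOn_mk (spinorFrameBundle P φ hφ) (glRep n M d)
        (frameInclusion_mem_atlas P φ hφ hσ) ψ).congr
        fun x _ => congrArg (TotalSpace.mk x) (extensionEquiv_mk P φ hφ (σ.2 x) ψ)
  exact ⟨h, contMDiff_symm_of_linearEquiv (fun x => (extensionEquiv P φ hφ x).restrictScalars ℝ) h⟩

end FrameBundle

/-! ### Tensors `γ` in frames -/

section GammaFrames

variable {r s d : ℕ} {M : Type u} [TopologicalSpace M]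
  [ChartedSpace (EuclideanSpace ℝ (Fin (r + s))) M]

/-- The continuous version of a linear frame of `T_x M`. -/
def tangentFrameL {x : M} (f : SigSpace r s ≃ₗ[ℝ] TSpace r s x) : SigSpace r s ≃L[ℝ] TSpace r s x :=
  haveI : T2Space (TSpace r s x) := inferInstanceAs (T2Space (EuclideanSpace ℝ (Fin (r + s))))
  f.toContinuousLinearEquiv

/-- The tensor in `T*_x M ⊗ End(V)` which has the components `T` in a frame `f` of `T_x M` and a
frame `q` of `V`. -/
def gammaOfFrames {x : M} {V : Type*} [AddCommGroup V] [Module ℂ V] [TopologicalSpace V]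
    [IsTopologicalAddGroup V] [ContinuousSMul ℂ V] (f : SigSpace r s ≃ₗ[ℝ] TSpace r s x)
    (q : Spinor d ≃L[ℂ] V) : GammaModel r s d ≃ₗ[ℝ] (TSpace r s x →L[ℝ] (V →L[ℂ] V)) :=
  let Q : (Spinor d →L[ℂ] Spinor d) ≃L[ℝ] (V →L[ℂ] V) :=
    { ((ContinuousLinearEquiv.arrowCongr q q).toLinearEquiv.restrictScalars ℝ) with
      continuous_toFun := (ContinuousLinearEquiv.arrowCongr q q).continuous
      continuous_invFun := (ContinuousLinearEquiv.arrowCongr q q).symm.continuous }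
  ((ContinuousLinearEquiv.arrowCongr (tangentFrameL f) Q).toLinearEquiv :
    (SigSpace r s →L[ℝ] (Spinor d →L[ℂ] Spinor d)) ≃ₗ[ℝ] (TSpace r s x →L[ℝ] (V →L[ℂ] V)))

theorem gammaOfFrames_apply {x : M} {V : Type*} [AddCommGroup V] [Module ℂ V] [TopologicalSpace V]
    [IsTopologicalAddGroup V] [ContinuousSMul ℂ V] (f : SigSpace r s ≃ₗ[ℝ] TSpace r s x)
    (q : Spinor d ≃L[ℂ] V) (T : GammaModel r s d) (v : SigSpace r s) (ψ : Spinor d) :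
    gammaOfFrames f q T (f v) (q ψ) = q (T.op v ψ) := by
  change q (T.op (f.symm (f v)) (q.symm (q ψ))) = _
  rw [f.symm_apply_apply, q.symm_apply_apply]

/-- `GL(D, ℝ) × GL(d, ℂ)` acts on the components of a tensor in the way which compensates a change
of the frames of `T_x M` and `E_x`. -/
theorem gammaRep_apply (A : GL (Fin r ⊕ Fin s) ℝ) (S : GL (Fin d) ℂ) (T : GammaModel r s d)
    (v : SigSpace r s) (ψ : Spinor d) :
    ((gammaRep (r + s) M r s d).rep (A, S) T).op (glAut A v) (matOp d S.val ψ) =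
      matOp d S.val (T.op v ψ) := by
  refine (gammaOp_apply _ _ _ T _ _).trans ?_
  have hA : realOp r s (A⁻¹).val (glAut A v) = v := (glAut A).symm_apply_apply v
  have hS : matOp d (S⁻¹).val (matOp d S.val ψ) = ψ := (glRep (r + s) M d).inv_rep S ψ
  exact congrArg (matOp d S.val) (congrArg₂ (fun a b => T.op a b) hA hS)

end GammaFrames

variable {r s : ℕ} {M : Type u} [TopologicalSpace M]
  [ChartedSpace (EuclideanSpace ℝ (Fin (r + s))) M] [IsManifold (𝓡 (r + s)) ∞ M]

/-! ### `T*M ⊗ End(E)` as an associated bundle -/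

section GammaBundle

variable {d : ℕ} (PG : PrincipalBundle.{u, w} (r + s) M (GL (Fin d) ℂ))

/-- The isomorphism from the fibre over `x` of the bundle associated to `L(M) ×_M P^G` to that of
`T*M ⊗ End(E^G)`. The auxiliary frame does not matter, see `gammaBundleEquiv_mk`. -/
def gammaBundleEquiv (x : M) :
    Assoc ((linearFrameBundle r s M).fiberProd PG) (gammaRep (r + s) M r s d) x ≃ₗ[ℝ]
      GammaFiber r s (Assoc PG (glRep (r + s) M d)) x :=
  let p := Assoc.someFrame ((linearFrameBundle r s M).fiberProd PG) x
  ((Assoc.frameL _ (gammaRep (r + s) M r s d) p).symm.toLinearEquiv.restrictScalars ℝ).trans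
    (gammaOfFrames p.1 (Assoc.frameL PG (glRep (r + s) M d) p.2))

theorem gammaBundleEquiv_mk_someFrame (x : M) (T : GammaModel r s d) :
    gammaBundleEquiv PG x (Assoc.mk _ (gammaRep (r + s) M r s d)
      (Assoc.someFrame ((linearFrameBundle r s M).fiberProd PG) x) T) =
      gammaOfFrames (Assoc.someFrame ((linearFrameBundle r s M).fiberProd PG) x).1
        (Assoc.frameL PG (glRep (r + s) M d)
          (Assoc.someFrame ((linearFrameBundle r s M).fiberProd PG) x).2) T :=
  congrArg (gammaOfFrames (Assoc.someFrame ((linearFrameBundle r s M).fiberProd PG) x).1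
    (Assoc.frameL PG (glRep (r + s) M d)
      (Assoc.someFrame ((linearFrameBundle r s M).fiberProd PG) x).2))
    (Assoc.frameL_symm_mk _ (gammaRep (r + s) M r s d) _ T)

theorem gammaBundleEquiv_mk {x : M} (f : SigSpace r s ≃ₗ[ℝ] TSpace r s x) (q : PG.Fiber x)
    (T : GammaModel r s d) (v : SigSpace r s) (ψ : Spinor d) :
    gammaBundleEquiv PG x (Assoc.mk ((linearFrameBundle r s M).fiberProd PG) _ (f, q) T) (f v)
      (Assoc.mk PG _ q ψ) = Assoc.mk PG _ q (T.op v ψ) := by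
  obtain ⟨⟨A, S⟩, hAS, -⟩ := ((linearFrameBundle r s M).fiberProd PG).existsUnique_act
    (Assoc.someFrame ((linearFrameBundle r s M).fiberProd PG) x) (f, q)
  have hf : (glAut A).trans (Assoc.someFrame ((linearFrameBundle r s M).fiberProd PG) x).1 = f :=
    congrArg Prod.fst hAS
  have hq : PG.act (Assoc.someFrame ((linearFrameBundle r s M).fiberProd PG) x).2 S = q :=
    congrArg Prod.snd hAS
  have h1 : Assoc.mk ((linearFrameBundle r s M).fiberProd PG) (gammaRep (r + s) M r s d) (f, q) T =
      Assoc.mk _ _ (Assoc.someFrame ((linearFrameBundle r s M).fiberProd PG) x)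
        ((gammaRep (r + s) M r s d).rep (A, S) T) :=
    (congrArg (fun p => Assoc.mk ((linearFrameBundle r s M).fiberProd PG) _ p T) hAS).symm.trans
      (Assoc.mk_act _ _ _ _ _)
  rw [h1, gammaBundleEquiv_mk_someFrame, ← hf, ← hq, Assoc.mk_act, Assoc.mk_act, glRep_apply,
    glRep_apply, ← gammaRep_apply (M := M) A S, ← Assoc.frameL_apply, ← Assoc.frameL_apply]
  exact gammaOfFrames_apply _ _ _ _ _

set_option synthInstance.maxHeartbeats 400000 in
set_option maxHeartbeats 1000000 in
theorem isSmoothIso_gammaBundleEquiv :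
    IsSmoothIso (n := r + s) (F := GammaModel r s d) (F' := GammaTarget r s d)
      (fun x => (gammaBundleEquiv PG x).toEquiv) := by
  have : FiniteDimensional ℝ (GammaModel r s d) := Module.Finite.trans (R := ℝ) ℂ _
  have h := Assoc.contMDiff_of_contMDiffOn_mk ((linearFrameBundle r s M).fiberProd PG)
    (gammaRep (r + s) M r s d) (F' := GammaTarget r s d)
    (fun x => (gammaBundleEquiv PG x).toLinearMap) (by
      rintro _ ⟨σ, hσ, τ, hτ, rfl⟩ T
      obtain ⟨e, he, hbase, hsymm⟩ := Assoc.exists_trivialization PG (glRep (r + s) M d) hτ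
      have h := contMDiffOn_gammaFiber σ.1.isOpen hσ e T (fun x => gammaBundleEquiv PG x
          (Assoc.mk ((linearFrameBundle r s M).fiberProd PG) _ (σ.2 x, τ.2 x) T))
        fun x hx v ψ => by
          have hx' : x ∈ τ.1 := by have := hx.2; rwa [hbase] at this
          rw [hsymm x hx', hsymm x hx']
          exact gammaBundleEquiv_mk PG (σ.2 x) (τ.2 x) T v ψ
      rw [hbase] at h
      exact h)
  exact ⟨h, contMDiff_symm_of_linearEquiv (gammaBundleEquiv PG) h⟩

end GammaBundle

/-! ### The Dirac structure -/

/-- The constant Dirac matrices as an element of `(ℝ^D)* ⊗ End(ℂ^d)`. -/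
def DiracMatrices.model (Γ : DiracMatrices r s) : GammaModel r s (dGamma r s) :=
  LinearMap.toContinuousLinearMap
    (((matOp (dGamma r s)).toLinearMap.restrictScalars ℝ).comp Γ.lin)

theorem DiracMatrices.model_op (Γ : DiracMatrices r s) (v : SigSpace r s) :
    Γ.model.op v = matOp _ (Γ.lin v) := rfl

variable {G : Type*} [Group G] [SmoothTarget (r + s) M G] {g : PseudoRiemannianMetric r s M}
  {o : ManifoldOrientation r s M}

/-- Let the points `p` of a principal `G`-bundle give frames `Φ(p)` of `TM` and `q(p)` of a vector
bundle `E`, on which `G` acts through `c : G → SO(r, s)` and through `φ`, where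
`φ(h) γ(v) = γ(c(h) v) φ(h)`. Then the tensor with constant components `γ_a` in these frames does not
depend on the frame, and is a Dirac structure on `E`. -/
theorem exists_diracStructure (Γ : DiracMatrices r s) (P : PrincipalBundle.{u, w} (r + s) M G)
    (Φ : ∀ x, P.Fiber x → SOFrame g o x)
    (hΦ : ∀ σ ∈ P.atlas, ∀ v, SmoothFieldOn (fun x => (Φ x (σ.2 x)).frame v) (σ.1 : Set M))
    (φ : G →* GL (Fin (dGamma r s)) ℂ) (c : G →* (SigSpace r s ≃ₗ[ℝ] SigSpace r s))
    (hc : ∀ x (p : P.Fiber x) (h : G) (v : SigSpace r s),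
      (Φ x (P.act p h)).frame v = (Φ x p).frame (c h v))
    (hφc : ∀ h v, (φ h).val * Γ.lin v = Γ.lin (c h v) * (φ h).val)
    {E : M → Type*} [∀ x, AddCommGroup (E x)] [∀ x, Module ℂ (E x)] [∀ x, TopologicalSpace (E x)]
    [∀ x, IsTopologicalAddGroup (E x)] [∀ x, ContinuousSMul ℂ (E x)]
    [TopologicalSpace (TotalSpace (Spinor (dGamma r s)) E)] [FiberBundle (Spinor (dGamma r s)) E]
    [VectorBundle ℂ (Spinor (dGamma r s)) E] [VectorBundle ℝ (Spinor (dGamma r s)) E]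
    [ContMDiffVectorBundle ∞ (Spinor (dGamma r s)) E (𝓡 (r + s))]
    (q : ∀ x, P.Fiber x → Spinor (dGamma r s) ≃L[ℂ] E x)
    (hq : ∀ x (p : P.Fiber x) (h : G) ψ, q x (P.act p h) ψ = q x p (matOp _ (φ h).val ψ))
    (hqs : ∀ σ ∈ P.atlas, ∃ e : Trivialization (Spinor (dGamma r s)) (π (Spinor (dGamma r s)) E),
      MemTrivializationAtlas e ∧ e.baseSet = σ.1 ∧ ∀ x ∈ σ.1, ∀ ψ, e.symm x ψ = q x (σ.2 x) ψ) :
    ∃ γ : ∀ x : M, GammaFiber r s E x, IsDiracStructure (dGamma r s) g γ ∧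
      ∀ x (p : P.Fiber x) (v : SigSpace r s) ψ,
        γ x ((Φ x p).frame v) (q x p ψ) = q x p (matOp _ (Γ.lin v) ψ) := by
  let γ : ∀ x : M, GammaFiber r s E x := fun x =>
    gammaOfFrames (Φ x (Assoc.someFrame P x)).frame (q x (Assoc.someFrame P x)) Γ.model
  have hγ : ∀ x (p : P.Fiber x) (v : SigSpace r s) ψ,
      γ x ((Φ x p).frame v) (q x p ψ) = q x p (matOp _ (Γ.lin v) ψ) := by
    intro x p v ψ
    obtain ⟨h, rfl, -⟩ := P.existsUnique_act (Assoc.someFrame P x) p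
    rw [hc, hq, hq]
    refine (gammaOfFrames_apply _ _ _ _ _).trans (congrArg _ ?_)
    rw [Γ.model_op]
    have h1 := congrArg (matOp (dGamma r s)) (hφc h v)
    rw [map_mul, map_mul] at h1
    exact (congrArg (fun L : Spinor (dGamma r s) →L[ℂ] Spinor (dGamma r s) => L ψ) h1).symm
  refine ⟨γ, ⟨fun x₀ => ?_, fun x X Y e => ?_⟩, hγ⟩
  · obtain ⟨σ, hσ, hx₀⟩ := P.cover x₀
    obtain ⟨e, he, hbase, hsymm⟩ := hqs σ hσ
    have h := contMDiffOn_gammaFiber σ.1.isOpen (hΦ σ hσ) e Γ.model γ fun x hx v ψ => by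
      rw [hsymm x hx.1, hsymm x hx.1, hγ, Γ.model_op]
    rw [hbase, Set.inter_self] at h
    exact h.contMDiffAt (σ.1.isOpen.mem_nhds hx₀)
  · set p := Assoc.someFrame P x
    obtain ⟨v, rfl⟩ := (Φ x p).frame.surjective X
    obtain ⟨w, rfl⟩ := (Φ x p).frame.surjective Y
    obtain ⟨ψ, rfl⟩ := (q x p).surjective e
    rw [hγ, hγ, hγ, hγ, ← map_add, (Φ x p).isometry, ← map_smul]
    refine congrArg _ ?_
    have h1 := congrArg (matOp (dGamma r s)) (Γ.lin_clifford v w)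
    rw [map_add, map_mul, map_mul, map_smul, map_one] at h1
    exact congrArg (fun L : Spinor (dGamma r s) →L[ℂ] Spinor (dGamma r s) => L ψ) h1

/-- The extension of the structure group to `GL(d_γ, ℂ)`, for `G = Spin(r, s)` and
`G = Spin^ℂ(r, s)` at once: all that matters is a faithful representation `φ` which the Dirac
matrices intertwine with a homomorphism `c` to `SO(r, s)`, and the `c`-equivariant map `Φ`. -/
theorem extendsToGL_of_intertwining (Γ : DiracMatrices r s)
    (P : PrincipalBundle.{u, w} (r + s) M G) (Φ : ∀ x, P.Fiber x → SOFrame g o x)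
    (hΦ : ∀ σ ∈ P.atlas, ∀ v, SmoothFieldOn (fun x => (Φ x (σ.2 x)).frame v) (σ.1 : Set M))
    (φ : G →* GL (Fin (dGamma r s)) ℂ)
    (hφ : ∀ (h : M → G) (U : Set M), SmoothTarget.SmoothOn (r + s) h U →
      SmoothTarget.SmoothOn (r + s) (fun x => φ (h x)) U)
    (hinj : Function.Injective φ) (c : G →* (SigSpace r s ≃ₗ[ℝ] SigSpace r s))
    (hc : ∀ x (p : P.Fiber x) (h : G) (v : SigSpace r s),
      (Φ x (P.act p h)).frame v = (Φ x p).frame (c h v))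
    (hφc : ∀ h v, (φ h).val * Γ.lin v = Γ.lin (c h v) * (φ h).val) :
    ExtendsToGL Γ P Φ φ hφ := by
  let ρ := (glRep (r + s) M (dGamma r s)).comap φ hφ
  let PG := spinorFrameBundle P φ hφ
  obtain ⟨γ, hγ, hγΓ⟩ := exists_diracStructure Γ P Φ hΦ φ c hc hφc
    (fun x p => Assoc.frameL P ρ p)
    (fun x p h ψ => by
      rw [Assoc.frameL_apply, Assoc.frameL_apply, Assoc.mk_act]
      rfl)
    (fun σ hσ => by
      obtain ⟨e, he, hbase, hsymm⟩ := Assoc.exists_trivialization P ρ hσ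
      exact ⟨e, he, hbase, fun x hx ψ => by rw [hsymm x hx, Assoc.frameL_apply]⟩)
  obtain ⟨γG, hγG, hγGΓ⟩ := exists_diracStructure Γ P Φ hΦ φ c hc hφc
    (fun x p => Assoc.frameL PG (glRep (r + s) M (dGamma r s)) (frameInclusion P φ hφ p))
    (fun x p h ψ => by
      rw [Assoc.frameL_apply, Assoc.frameL_apply]
      exact mk_frameInclusion_act P φ hφ p h ψ)
    (fun σ hσ => by
      obtain ⟨e, he, hbase, hsymm⟩ := Assoc.exists_trivialization PG
        (glRep (r + s) M (dGamma r s)) (frameInclusion_mem_atlas P φ hφ hσ)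
      exact ⟨e, he, hbase, fun x hx ψ => by rw [hsymm x hx, Assoc.frameL_apply]⟩)
  simp only [Assoc.frameL_apply] at hγΓ hγGΓ
  refine ⟨hinj, γ, ⟨hγ, hγΓ⟩, PG, fun x p => frameInclusion P φ hφ p,
    fun x => frameInclusion_injective P φ hφ hinj, fun x p h => frameInclusion_act P φ hφ p h,
    fun σ hσ => isSmoothSectionOn_frameInclusion P φ hφ hσ, extensionEquiv P φ hφ,
    isSmoothIso_extensionEquiv P φ hφ, fun x p ψ => extensionEquiv_mk P φ hφ p ψ,
    ⟨gammaBundleEquiv PG, isSmoothIso_gammaBundleEquiv PG,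
      fun x f q T v ψ => gammaBundleEquiv_mk PG f q T v ψ⟩, γG, ⟨hγG, fun x X e => ?_⟩, ?_⟩
  · let p := Assoc.someFrame P x
    obtain ⟨v, rfl⟩ := (Φ x p).frame.surjective X
    obtain ⟨ψ, rfl⟩ := (Assoc.mk_bijective P ρ p).2 e
    rw [hγΓ, extensionEquiv_mk, extensionEquiv_mk, hγGΓ]
  · rintro γ' ⟨-, hγ'⟩
    funext x
    refine ContinuousLinearMap.ext fun X => ContinuousLinearMap.ext fun e' => ?_
    obtain ⟨e, rfl⟩ := (extensionEquiv P φ hφ x).surjective e'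
    rw [hγ']
    let p := Assoc.someFrame P x
    obtain ⟨v, rfl⟩ := (Φ x p).frame.surjective X
    obtain ⟨ψ, rfl⟩ := (Assoc.mk_bijective P ρ p).2 e
    rw [hγΓ, extensionEquiv_mk, extensionEquiv_mk, hγGΓ]

end SpinBase

end

theorem theorem2 (r s : ℕ) (hD : 3 ≤ r + s) {M : Type u} [TopologicalSpace M]
    [ChartedSpace (EuclideanSpace ℝ (Fin (r + s))) M]
    [IsManifold (𝓡 (r + s)) ∞ M] [T2Space M] [ParacompactSpace M] [ConnectedSpace M]
    (g : SpinBase.PseudoRiemannianMetric r s M) (o : SpinBase.ManifoldOrientation r s M)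
    (Γ : SpinBase.DiracMatrices r s) :
    (∀ S : SpinBase.SpinStructure.{u, w} g o,
      SpinBase.ExtendsToGL Γ S.bundle S.Φ Γ.spinRep (SpinBase.spinRep_smooth Γ)) ∧
    (∀ S : SpinBase.SpinCStructure.{u, w, w'} g o,
      SpinBase.ExtendsToGL Γ S.bundle S.Φ Γ.spinCRep (SpinBase.spinCRep_smooth Γ)) :=
  ⟨fun S => SpinBase.extendsToGL_of_intertwining Γ S.bundle S.Φ S.smooth Γ.spinRep
      (SpinBase.spinRep_smooth Γ) Γ.spinRep_injective (SpinBase.spinCover r s) S.equivariant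
      Γ.spinRep_mul_lin,
    fun S => SpinBase.extendsToGL_of_intertwining Γ S.bundle S.Φ S.smooth Γ.spinCRep
      (SpinBase.spinCRep_smooth Γ) Γ.spinCRep_injective (SpinBase.spinCCover r s) S.equivariant
      Γ.spinCRep_mul_lin⟩
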